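/- **Setting (AdWords).** Let $A$ be a finite set of at least two advertisers with budgets $B_a>0$. Impressions arrive one at a time in a list $I$; impression $i$ comes with bids $b_{ai}\ge 0$ ($a\in A$) and must be assigned irrevocably to an advertiser. For a set $S$ of impressions let $b_a(S)=\min\{\sum_{i\in S}b_{ai},B_a\}$. The objective of an assignment is $\sum_a b_a(S_a)$, where $S_a$ is the set of impressions assigned to $a$; an online algorithm is $\Gamma$-competitive on a class of instances if, on each of them, its expected objective is at least $\Gamma$ times the maximum objective over all assignments of the impressions. **PanOCS.** A PanOCS is a randomized online algorithm that receives a sequence of pairs of advertiser-subset combinations $(a,Y)$ and immediately selects one combination of each pair. For $0\le\gamma\le 1$, it is a $\gamma$-PanOCS on a class $\mathcal S$ of input sequences if for every input in $\mathcal S$, every $a\in A$ and every $y\in[0,B_a)$, with probability at least $1-2^{-k}(1-\gamma)^{\max\{k-1,0\}}$ at least one selected combination $(a',Y)$ has $a'=a$ and $y\in Y$, where $k$ is the number of pairs having such a combination as a member. **Factor LP.** Let $\Delta x(1)=\frac12$ and $\Delta x(k)=2^{-k}(1-\gamma)^{k-2}(1+\gamma)$ for $k\ge 2$. A triple $\Gamma\in\mathbb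 R$, $(\Delta\alpha(k))_{k\ge1}$, $(\Delta\beta(k))_{k\ge1}$ with $\Delta\alpha(k),\Delta\beta(k)\ge 0$ is a feasible solution if - $\Delta\beta(k)=\Delta x(k)-\Delta\alpha(k)$ for $k\ge1$; - $\sum_{\ell=1}^k\Delta\alpha(\ell)+2\Delta\beta(k+1)\ge\Gamma$ for $k\ge0$; - $\Delta\beta(k)\ge\sum_{\ell=k+1}^\infty\Delta\beta(\ell)$ for $k\ge1$; - $\sum_{\ell=1}^k\Delta\alpha(\ell)+\sum_{\ell=k}^\infty\Delta\beta(\ell)\ge\Gamma$ for $k\ge1$; - $\sum_{\ell=1}^\infty\Delta\alpha(\ell)\ge\Gamma$; - $\Delta\beta(k)\ge\Delta\beta(k+1)$ for $k\ge1$. **Basic algorithm** (with parameters $\gamma$, $(\Delta\alpha(k))_{k\ge 1}$ and $\Delta\beta=\Delta x-\Delta\alpha$). For every $a$ it maintains $k_a:[0,B_a)\to\{0,1,2,\dots,\infty\}$, initially $0$, and a point $y_a^*\in[0,B_a)$, initially $0$. Glue the endpoints of $[0,B_a)$ to a circle and let $Y_D=\{y:k_a(y)=\infty\}$. When impression $i$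 arrives, let $Y_{ai}=[y_a^*,z)\setminus Y_D$, where $z$ is a point with $\mu([y_a^*,z)\setminus Y_D)=b_{ai}$ on the circle ($\mu$ is Lebesgue measure); if $b_{ai}\ge B_a-\mu(Y_D)$, let instead $Y_{ai}=[0,B_a)\setminus Y_D$ and $z=y_a^*$. Put $$\Delta_a^R\beta_i=\int_{Y_{ai}}\Delta\beta(k_a(y)+1)\,dy,\qquad \Delta_a^D\beta_i=\int_{Y_{ai}}\sum_{\ell>k_a(y)}\Delta\beta(\ell)\,dy .$$ Let $a_1\ne a_2$ be two advertisers with the largest values $\Delta_a^R\beta_i$ and let $a^*$ have the largest $\Delta_a^D\beta_i$ (ties are broken by any deterministic rule based on the impressions that have arrived). - If $\Delta_{a_1}^R\beta_i+\Delta_{a_2}^R\beta_i\ge\Delta_{a^*}^D\beta_i$, then $(a_1,Y_{a_1i}),(a_2,Y_{a_2i})$ is the next pair of the PanOCS, $i$ is assigned to the selected advertiser, $k_a$ increases by $1$ on $Y_{ai}$ and $y^*_a$ becomes the corresponding $z$ for $a\in\{a_1,a_2\}$, and $\beta_i:=\Delta_{a_1}^R\beta_i+\Delta_{a_2}^R\beta_i$.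 - Otherwise $i$ is assigned to $a^*$, $k_{a^*}$ becomes $\infty$ on $Y_{a^*i}$, $y^*_{a^*}$ becomes the corresponding $z$, and $\beta_i:=\Delta_{a^*}^D\beta_i$. At the end let $\alpha_a=\int_0^{B_a}\sum_{\ell=1}^{k_a(y)}\Delta\alpha(\ell)\,dy$, with the final $k_a$. **Theorem.** Let $0\le\gamma\le1$ and let $(\Gamma,\Delta\alpha,\Delta\beta)$ be any feasible solution of the factor LP. 1. (Approximate dual feasibility for the configuration LP.) On every instance, $\alpha_a\ge0$ for all $a\in A$, $\beta_i\ge0$ for all impressions $i$, and $$\alpha_a+\sum_{i\in S}\beta_i\ \ge\ \Gamma\cdot b_a(S)\qquad\text{for all } a\in A \text{ and all sets } S \text{ of impressions.}$$ 2. For every class $\mathcal S$ of input sequences and every $\gamma$-PanOCS on $\mathcal S$, the basic algorithm with this PanOCS is $\Gamma$-competitive on all instances for which its sequence of pairs belongs to $\mathcal S$. In particular, if $\mathcal S$ contains all sequences of pairs, it is $\Gamma$-competitive on all instances. -/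

import Mathlib

open MeasureTheory Set

noncomputable section

namespace AdWords

/-! ### Instances, offline optimum, online algorithms

An impression is the vector `A → ℝ` of the bids for it, and the impressions are a list in their
order of arrival. Budgets are a function `B : A → ℝ`. -/

/-- The budget-additive payment `min {∑_{i ∈ S} b_{ai}, B_a}`. -/
def payment {A : Type*} (B : A → ℝ) (I : List (A → ℝ)) (a : A) (S : Finset (Fin I.length)) : ℝ :=
  min (∑ i ∈ S, I.get i a) (B a)

/-- The total payment when each impression `i` is assigned to the advertiser `f i`. -/
def objective {A : Type*} [Fintype A] [DecidableEq A] (B : A → ℝ) (I : List (A → ℝ))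
    (f : Fin I.length → A) : ℝ :=
  ∑ a, payment B I a (Finset.univ.filter fun i => f i = a)

/-- The offline optimum (a maximum over finitely many assignments). -/
def offlineOpt {A : Type*} [Fintype A] [DecidableEq A] (B : A → ℝ) (I : List (A → ℝ)) : ℝ :=
  ⨆ f : Fin I.length → A, objective B I f

/-- A randomized online algorithm: from the random seed, the earlier impressions and the current
impression it computes the advertiser to which the current impression is assigned. -/
structure OnlineAlgorithm (A Ω : Type*) [MeasurableSpace Ω] where
  assign : Ω → List (A → ℝ) → (A → ℝ) → A
  measurableSet_assign : ∀ past b a, MeasurableSet {ω | assign ω past b = a}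

/-- The expected objective on the instance `I`; round `i` sees the impressions up to `i` only. -/
def OnlineAlgorithm.expectedObjective {A Ω : Type*} [Fintype A] [DecidableEq A]
    [MeasurableSpace Ω] (alg : OnlineAlgorithm A Ω) (P : Measure Ω) (B : A → ℝ)
    (I : List (A → ℝ)) : ℝ :=
  ∫ ω, objective B I (fun i => alg.assign ω (I.take i) (I.get i)) ∂P

/-- `Γ`-competitiveness on a class of instances. -/
def OnlineAlgorithm.IsCompetitiveOn {A Ω : Type*} [Fintype A] [DecidableEq A]
    [MeasurableSpace Ω] (alg : OnlineAlgorithm A Ω) (P : Measure Ω) (B : A → ℝ) (Γ : ℝ)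
    (𝓘 : Set (List (A → ℝ))) : Prop :=
  ∀ I ∈ 𝓘, Γ * offlineOpt B I ≤ alg.expectedObjective P B I

/-- Dual feasibility for the configuration LP of the instance `I`, up to the factor `Γ`. -/
def ApproxDualFeasible {A : Type*} (B : A → ℝ) (Γ : ℝ) (I : List (A → ℝ))
    (α : A → ℝ) (β : Fin I.length → ℝ) : Prop :=
  (∀ a, 0 ≤ α a) ∧ (∀ i, 0 ≤ β i) ∧
    ∀ (a : A) (S : Finset (Fin I.length)), Γ * payment B I a S ≤ α a + ∑ i ∈ S, β i

/-! ### Panoramic online correlated selection -/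

/-- An advertiser-subset combination. -/
abbrev Combo (A : Type*) := A × Set ℝ

/-- A pair of advertiser-subset combinations: the input of one randomized round. -/
abbrev ComboPair (A : Type*) := Combo A × Combo A

/-- An online algorithm selecting one combination of each pair: from the random seed, the earlier
pairs and the current pair it computes whether the first (`true`) or the second (`false`)
combination of the current pair is selected. -/
structure PanOCS (A Ω : Type*) [MeasurableSpace Ω] where
  select : Ω → List (ComboPair A) → ComboPair A → Bool
  measurable_select : ∀ past p, Measurable fun ω => select ω past p

/-- The combination selected from the pair `p`. -/
def PanOCS.selected {A Ω : Type*} [MeasurableSpace Ω] (Q : PanOCS A Ω) (ω : Ω)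
    (past : List (ComboPair A)) (p : ComboPair A) : Combo A :=
  if Q.select ω past p then p.1 else p.2

open Classical in
/-- The number of rounds of `L` in which the point `y` of advertiser `a` is semi-assigned. -/
def semiCount {A : Type*} (L : List (ComboPair A)) (a : A) (y : ℝ) : ℕ :=
  L.countP fun p => (p.1.1 = a ∧ y ∈ p.1.2) ∨ (p.2.1 = a ∧ y ∈ p.2.2)

/-- The event that the point `y` of `a` is assigned in at least one of the rounds of `L`. -/
def PanOCS.assignedEvent {A Ω : Type*} [MeasurableSpace Ω] (Q : PanOCS A Ω)
    (L : List (ComboPair A)) (a : A) (y : ℝ) : Set Ω :=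
  {ω | ∃ t : Fin L.length, (Q.selected ω (L.take t) (L.get t)).1 = a ∧
    y ∈ (Q.selected ω (L.take t) (L.get t)).2}

/-- The guarantee of a `γ`-PanOCS on every input sequence of the class `𝒮`
(`𝒮 = Set.univ`: on all input sequences). -/
def PanOCS.IsGammaOn {A Ω : Type*} [MeasurableSpace Ω] (Q : PanOCS A Ω) (P : Measure Ω)
    (B : A → ℝ) (γ : ℝ) (𝒮 : Set (List (ComboPair A))) : Prop :=
  ∀ L ∈ 𝒮, ∀ (a : A), ∀ y ∈ Ico 0 (B a),
    1 - (1 / 2 : ℝ) ^ semiCount L a y * (1 - γ) ^ (semiCount L a y - 1)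
      ≤ P.real (Q.assignedEvent L a y)

/-! ### The factor LP

Sequences are functions on `ℕ` of which only the values at `k ≥ 1` matter. -/

/-- `Δx(k)`, `k ≥ 1`. -/
def deltaX (γ : ℝ) (k : ℕ) : ℝ :=
  if k ≤ 1 then 1 / 2 else (1 / 2) ^ k * (1 - γ) ^ (k - 2) * (1 + γ)

/-- The constraints of the infinite factor LP. -/
structure FactorLPFeasible (γ Γ : ℝ) (Δα Δβ : ℕ → ℝ) : Prop where
  alpha_nonneg : ∀ k, 1 ≤ k → 0 ≤ Δα k
  beta_nonneg : ∀ k, 1 ≤ k → 0 ≤ Δβ k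
  invariant : ∀ k, 1 ≤ k → Δβ k = deltaX γ k - Δα k
  not_to_a : ∀ k, Γ ≤ (∑ l ∈ Finset.Icc 1 k, Δα l) + 2 * Δβ (k + 1)
  random_vs_deter : ∀ k, 1 ≤ k → (∑' j : ℕ, Δβ (k + 1 + j)) ≤ Δβ k
  half_to_a : ∀ k, 1 ≤ k → Γ ≤ (∑ l ∈ Finset.Icc 1 k, Δα l) + ∑' j : ℕ, Δβ (k + j)
  at_limit : Γ ≤ ∑' j : ℕ, Δα (1 + j)
  monotone : ∀ k, 1 ≤ k → Δβ (k + 1) ≤ Δβ k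

/-- `∑_{l = 1}^{k} f l`, where `k` may be `∞`. -/
def headSum (f : ℕ → ℝ) (k : ℕ∞) : ℝ :=
  if k = ⊤ then ∑' j : ℕ, f (1 + j) else ∑ l ∈ Finset.Icc 1 k.toNat, f l

/-- `∑_{l > k} f l`, where `k` may be `∞`. -/
def tailSum (f : ℕ → ℝ) (k : ℕ∞) : ℝ :=
  if k = ⊤ then 0 else ∑' j : ℕ, f (k.toNat + 1 + j)

/-! ### Panoramic interval-level assignment -/

/-- The arc `[y, z)` of the circle obtained by gluing the endpoints of `[0, B)`. -/
def arc (B y z : ℝ) : Set ℝ :=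
  if y ≤ z then Ico y z else Ico y B ∪ Ico 0 z

/-- `y ⊕_Y b`: a point of `[0, B)` such that `[y, y ⊕_Y b) \ Y` has measure `b`, and `y` itself if
the complement of `Y` has measure at most `b`. (Two points with this property differ only by
a stretch of the circle that lies in `Y` up to a null set.) -/
def oplus (B : ℝ) (Y : Set ℝ) (y b : ℝ) : ℝ :=
  if b < B - volume.real Y then
    Classical.epsilon fun z => z ∈ Ico 0 B ∧ volume.real (arc B y z \ Y) = b
  else y

/-- The subset `[y, y ⊕_Y b) \ Y` reached by scanning the circle from `y`, at most once around;
if the complement of `Y` has measure at most `b`, this is the full circle without `Y`. -/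
def panSubset (B : ℝ) (Y : Set ℝ) (y b : ℝ) : Set ℝ :=
  if b < B - volume.real Y then arc B y (oplus B Y y b) \ Y else Ico 0 B \ Y

/-! ### The basic algorithm -/

/-- A deterministic rule for "find `a₁`, `a₂` (distinct) with the largest values" and "find `a`
with the largest value"; ties may be broken depending on the impressions that have arrived. -/
structure ArgmaxRule (A : Type*) where
  topTwo : List (A → ℝ) → (A → ℝ) → A × A
  top : List (A → ℝ) → (A → ℝ) → A
  topTwo_ne : ∀ (I : List (A → ℝ)) (v : A → ℝ), (topTwo I v).1 ≠ (topTwo I v).2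
  le_topTwo : ∀ (I : List (A → ℝ)) (v : A → ℝ) (a : A), a ≠ (topTwo I v).1 → a ≠ (topTwo I v).2 →
    v a ≤ v (topTwo I v).1 ∧ v a ≤ v (topTwo I v).2
  le_top : ∀ (I : List (A → ℝ)) (v : A → ℝ) (a : A), v a ≤ v (top I v)

/-- The data that the algorithm maintains. -/
structure State (A : Type*) where
  /-- `k a y`: how often `y` has been semi-assigned; `⊤` after a deterministic assignment. -/
  k : A → ℝ → ℕ∞
  /-- The start point `y*` of the next subset, for each advertiser. -/
  start : A → ℝ
  /-- The input of the PanOCS so far. -/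
  semi : List (ComboPair A)
  /-- The impressions so far. -/
  arrived : List (A → ℝ)

def State.init (A : Type*) : State A where
  k := fun _ _ => 0
  start := fun _ => 0
  semi := []
  arrived := []

/-- The decision in a round. -/
inductive Decision (A : Type*) where
  | randomized (a₁ a₂ : A)
  | deterministic (a : A)

/-- `Δβ(k) = Δx(k) - Δα(k)`. -/
def deltaBeta (γ : ℝ) (Δα : ℕ → ℝ) (k : ℕ) : ℝ := deltaX γ k - Δα k

/-- The set `Y_D` of the points of `a` that have been assigned deterministically. -/
def State.detSet {A : Type*} (B : A → ℝ) (st : State A) (a : A) : Set ℝ :=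
  {y | y ∈ Ico 0 (B a) ∧ st.k a y = ⊤}

/-- The subset `Y_{ai}` for an impression with bids `b` arriving in state `st`. -/
def State.subset {A : Type*} (B : A → ℝ) (st : State A) (b : A → ℝ) (a : A) : Set ℝ :=
  panSubset (B a) (st.detSet B a) (st.start a) (b a)

/-- The start point after (semi-)assigning an impression with bids `b` to `a`. -/
def State.nextStart {A : Type*} (B : A → ℝ) (st : State A) (b : A → ℝ) (a : A) : ℝ :=
  oplus (B a) (st.detSet B a) (st.start a) (b a)

/-- `Δ_a^R β_i = ∫_{Y_{ai}} Δβ(k_a(y) + 1) dy`; note that `k_a` is finite on `Y_{ai}`. -/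
def deltaR {A : Type*} (B : A → ℝ) (γ : ℝ) (Δα : ℕ → ℝ) (st : State A) (b : A → ℝ) (a : A) : ℝ :=
  ∫ y in st.subset B b a, deltaBeta γ Δα ((st.k a y).toNat + 1)

/-- `Δ_a^D β_i = ∫_{Y_{ai}} ∑_{l > k_a(y)} Δβ(l) dy`. -/
def deltaD {A : Type*} (B : A → ℝ) (γ : ℝ) (Δα : ℕ → ℝ) (st : State A) (b : A → ℝ) (a : A) : ℝ :=
  ∫ y in st.subset B b a, tailSum (deltaBeta γ Δα) (st.k a y)

/-- The decision for an impression with bids `b` arriving in state `st`. -/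
def decision {A : Type*} (B : A → ℝ) (γ : ℝ) (Δα : ℕ → ℝ) (T : ArgmaxRule A) (st : State A)
    (b : A → ℝ) : Decision A :=
  let r := T.topTwo (st.arrived ++ [b]) (deltaR B γ Δα st b)
  let d := T.top (st.arrived ++ [b]) (deltaD B γ Δα st b)
  if deltaD B γ Δα st b d ≤ deltaR B γ Δα st b r.1 + deltaR B γ Δα st b r.2 then
    .randomized r.1 r.2
  else .deterministic d

/-- The pair passed to the PanOCS when semi-assigning to `a₁` and `a₂`. -/
def State.pair {A : Type*} (B : A → ℝ) (st : State A) (b : A → ℝ) (a₁ a₂ : A) : ComboPair A :=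
  ((a₁, st.subset B b a₁), (a₂, st.subset B b a₂))

open Classical in
/-- One round. It does not involve the random seed. -/
def step {A : Type*} (B : A → ℝ) (γ : ℝ) (Δα : ℕ → ℝ) (T : ArgmaxRule A) (st : State A)
    (b : A → ℝ) : State A :=
  match decision B γ Δα T st b with
  | .randomized a₁ a₂ =>
    { k := fun a y =>
        if (a = a₁ ∨ a = a₂) ∧ y ∈ st.subset B b a then st.k a y + 1 else st.k a y
      start := fun a => if a = a₁ ∨ a = a₂ then st.nextStart B b a else st.start a
      semi := st.semi ++ [st.pair B b a₁ a₂]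
      arrived := st.arrived ++ [b] }
  | .deterministic d =>
    { k := fun a y => if a = d ∧ y ∈ st.subset B b a then ⊤ else st.k a y
      start := fun a => if a = d then st.nextStart B b a else st.start a
      semi := st.semi
      arrived := st.arrived ++ [b] }

/-- The state after processing the impressions `I`. -/
def runState {A : Type*} (B : A → ℝ) (γ : ℝ) (Δα : ℕ → ℝ) (T : ArgmaxRule A)
    (I : List (A → ℝ)) : State A :=
  I.foldl (step B γ Δα T) (State.init A)

/-- The basic online primal dual algorithm with the PanOCS `Q`. -/
def basicAlgorithm {A Ω : Type*} [MeasurableSpace Ω] (B : A → ℝ) (γ : ℝ) (Δα : ℕ → ℝ)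
    (T : ArgmaxRule A) (Q : PanOCS A Ω) : OnlineAlgorithm A Ω where
  assign := fun ω past b =>
    match decision B γ Δα T (runState B γ Δα T past) b with
    | .randomized a₁ a₂ =>
      (Q.selected ω (runState B γ Δα T past).semi ((runState B γ Δα T past).pair B b a₁ a₂)).1
    | .deterministic d => d
  measurableSet_assign := by
    intro past b a
    cases decision B γ Δα T (runState B γ Δα T past) b with
    | randomized a₁ a₂ =>
      exact (Q.measurable_select (runState B γ Δα T past).semi
        ((runState B γ Δα T past).pair B b a₁ a₂))
        (MeasurableSet.of_discrete (s := {c : Bool | ((if c then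
          ((runState B γ Δα T past).pair B b a₁ a₂).1
          else ((runState B γ Δα T past).pair B b a₁ a₂).2) : Combo A).1 = a}))
    | deterministic d => exact MeasurableSet.const (d = a)

/-- The dual variable `α_a = ∫_0^{B_a} ∑_{l = 1}^{k_a(y)} Δα(l) dy` at the end of the run. -/
def alphaVar {A : Type*} (B : A → ℝ) (γ : ℝ) (Δα : ℕ → ℝ) (T : ArgmaxRule A)
    (I : List (A → ℝ)) (a : A) : ℝ :=
  ∫ y in Ico 0 (B a), headSum Δα ((runState B γ Δα T I).k a y)

/-- The dual variable `β_i`, set in the round of impression `i`. -/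
def betaVar {A : Type*} (B : A → ℝ) (γ : ℝ) (Δα : ℕ → ℝ) (T : ArgmaxRule A)
    (I : List (A → ℝ)) (i : Fin I.length) : ℝ :=
  match decision B γ Δα T (runState B γ Δα T (I.take i)) (I.get i) with
  | .randomized a₁ a₂ =>
    deltaR B γ Δα (runState B γ Δα T (I.take i)) (I.get i) a₁ +
      deltaR B γ Δα (runState B γ Δα T (I.take i)) (I.get i) a₂
  | .deterministic d => deltaD B γ Δα (runState B γ Δα T (I.take i)) (I.get i) d

end AdWords

end

namespace AdWords

/-! ### Head and tail sums -/

/-! The argument is online primal-dual, carried out pointwise on the budget intervals `[0, B a)`. It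
has two independent halves, joined at the end by weak duality.

Dual value against expected objective. Since `Δα + Δβ = Δx` and the partial sums of `Δx` telescope,
a point with final counter `k` carries the total dual charge `headSum (deltaX γ) k`. For finite `k`
this is exactly the probability with which a `γ`-PanOCS covers a point occurring in `k` pairs, and
for `k = ⊤` it is `1`. The value `β` of a round is precisely the growth of the `Δβ` part of this
charge (`sum_betaVar`). For each seed, the covered points of `a` lie in scanned subsets of
impressions assigned to `a`, whose measures are at most the bids, so the covered measure is at most
the payment. Fubini then gives `sum_dual_le_expectedObjective`.

Dual feasibility. Scanning the circle keeps the finite counters of an advertiser on two adjacent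
levels, separated by the start point (`IsPanoramic`). At the end every point is therefore at `⊤`, at
the lowest level `m`, or at `m + 1`. Points at `⊤` already contribute `Γ` to `α`. The others fall
short by at most `x` at level `m` and `x'` at level `m + 1`, where `x' ≤ x`. A round in which the
advertiser is passed over or semi-assigned contributes to `β` at least `x` per scanned point, except
on a critical part where only `x'` is guaranteed. These bounds come from the LP constraints
(`beta_ge_of_semi`, `beta_ge_of_none`). Deterministic rounds need no `β`: their subsets are disjoint
and end at `⊤`. Two covering inequalities, one for all finite points and one for those at level `m`,
show that the scanned measure makes up the deficit (`CounterHistory.payment_le_of_level`). -/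

theorem headSum_top (f : ℕ → ℝ) : headSum f ⊤ = ∑' j : ℕ, f (1 + j) := if_pos rfl

theorem headSum_natCast (f : ℕ → ℝ) (n : ℕ) :
    headSum f n = ∑ l ∈ Finset.Icc 1 n, f l := by
  simp [headSum]

theorem sum_Icc_one_eq_sum_range (f : ℕ → ℝ) (n : ℕ) :
    ∑ l ∈ Finset.Icc 1 n, f l = ∑ j ∈ Finset.range n, f (1 + j) := by
  induction n with
  | zero => simp
  | succ n ih => rw [Finset.sum_Icc_succ_top (by omega), ih, Finset.sum_range_succ, add_comm n 1]

theorem headSum_natCast_succ (f : ℕ → ℝ) (n : ℕ) :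
    headSum f (n + 1 : ℕ) = headSum f n + f (n + 1) := by
  rw [headSum_natCast, headSum_natCast, Finset.sum_Icc_succ_top (by omega)]

theorem headSum_zero (f : ℕ → ℝ) : headSum f 0 = 0 := by
  simp [headSum]

theorem tailSum_top (f : ℕ → ℝ) : tailSum f ⊤ = 0 := if_pos rfl

theorem tailSum_natCast (f : ℕ → ℝ) (n : ℕ) :
    tailSum f n = ∑' j : ℕ, f (n + 1 + j) := by
  simp [tailSum]

theorem headSum_add_tailSum {f : ℕ → ℝ} (hf : Summable fun j => f (1 + j)) (k : ℕ∞) :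
    headSum f k + tailSum f k = headSum f ⊤ := by
  induction k with
  | top => rw [tailSum_top, add_zero]
  | coe n =>
    rw [headSum_natCast, tailSum_natCast, headSum_top, sum_Icc_one_eq_sum_range,
      ← hf.sum_add_tsum_nat_add n]
    congr 2
    ext j
    congr 1
    omega

theorem tailSum_natCast_eq_add {f : ℕ → ℝ} (hf : Summable fun j => f (1 + j)) (n : ℕ) :
    tailSum f n = f (n + 1) + tailSum f (n + 1 : ℕ) := by
  have h₁ := headSum_add_tailSum hf n
  have h₂ := headSum_add_tailSum hf (n + 1 : ℕ)
  rw [headSum_natCast_succ] at h₂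
  linarith

theorem headSum_nonneg {f : ℕ → ℝ} (hf : ∀ k, 1 ≤ k → 0 ≤ f k) (k : ℕ∞) : 0 ≤ headSum f k := by
  induction k with
  | top => exact headSum_top f ▸ tsum_nonneg fun j => hf _ (by omega)
  | coe n =>
    rw [headSum_natCast]
    exact Finset.sum_nonneg fun l hl => hf l (Finset.mem_Icc.1 hl).1

theorem tailSum_nonneg {f : ℕ → ℝ} (hf : ∀ k, 1 ≤ k → 0 ≤ f k) (k : ℕ∞) : 0 ≤ tailSum f k := by
  induction k with
  | top => rw [tailSum_top]
  | coe n => exact tailSum_natCast f n ▸ tsum_nonneg fun j => hf _ (by omega)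

theorem tailSum_natCast_antitone {f : ℕ → ℝ} (hs : Summable fun j => f (1 + j))
    (hf : ∀ k, 1 ≤ k → 0 ≤ f k) : Antitone fun n : ℕ => tailSum f n :=
  antitone_nat_of_succ_le fun n => by
    rw [tailSum_natCast_eq_add hs n]
    linarith [hf (n + 1) (by omega)]

theorem headSum_add {f g : ℕ → ℝ} (hf : Summable fun j => f (1 + j))
    (hg : Summable fun j => g (1 + j)) (k : ℕ∞) :
    headSum (fun l => f l + g l) k = headSum f k + headSum g k := by
  induction k with
  | top => simp only [headSum_top, hf.tsum_add hg]
  | coe n => simp only [headSum_natCast, Finset.sum_add_distrib]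

/-! ### The increments `Δx` -/

theorem deltaX_nonneg {γ : ℝ} (hγ₀ : 0 ≤ γ) (hγ₁ : γ ≤ 1) (k : ℕ) : 0 ≤ deltaX γ k := by
  have : 0 ≤ 1 - γ := by linarith
  unfold deltaX
  split_ifs <;> positivity

/-- The increments telescope, which ties the factor LP to the PanOCS guarantee. At `n = 0` the
truncated exponent `n - 1` is `0`, so both sides vanish. -/
theorem headSum_deltaX_natCast (γ : ℝ) (n : ℕ) :
    headSum (deltaX γ) n = 1 - (1 / 2) ^ n * (1 - γ) ^ (n - 1) := by
  induction n with
  | zero => simp [headSum]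
  | succ n ih =>
    rw [headSum_natCast_succ, ih]
    rcases n with _ | n
    · norm_num [deltaX]
    · simp only [deltaX, Nat.add_sub_cancel]
      rw [if_neg (by omega), show n + 1 + 1 - 2 = n by omega]
      ring

theorem hasSum_deltaX {γ : ℝ} (hγ₀ : 0 ≤ γ) (hγ₁ : γ ≤ 1) :
    HasSum (fun j => deltaX γ (1 + j)) 1 := by
  rw [hasSum_iff_tendsto_nat_of_nonneg fun j => deltaX_nonneg hγ₀ hγ₁ _]
  simp only [← sum_Icc_one_eq_sum_range, ← headSum_natCast, headSum_deltaX_natCast]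
  have h : Filter.Tendsto (fun n : ℕ => (1 / 2 : ℝ) ^ n * (1 - γ) ^ (n - 1))
      Filter.atTop (nhds 0) := by
    refine squeeze_zero (fun n => ?_) (fun n => ?_)
      (tendsto_pow_atTop_nhds_zero_of_lt_one (r := (1 / 2 : ℝ)) (by norm_num) (by norm_num))
    · have : 0 ≤ 1 - γ := by linarith
      positivity
    · exact mul_le_of_le_one_right (by positivity)
        (pow_le_one₀ (by linarith) (by linarith))
  simpa using h.const_sub 1

theorem headSum_deltaX_top {γ : ℝ} (hγ₀ : 0 ≤ γ) (hγ₁ : γ ≤ 1) : headSum (deltaX γ) ⊤ = 1 := by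
  rw [headSum_top, (hasSum_deltaX hγ₀ hγ₁).tsum_eq]

/-! ### Feasible solutions of the factor LP -/

/-- The algorithm computes with `deltaBeta`, which may differ from the given `Δβ` at index `0`. The
constraints involve only indices from `1` on, so feasibility transfers. -/
theorem FactorLPFeasible.to_deltaBeta {γ Γ : ℝ} {Δα Δβ : ℕ → ℝ}
    (h : FactorLPFeasible γ Γ Δα Δβ) : FactorLPFeasible γ Γ Δα (deltaBeta γ Δα) := by
  have e : ∀ k, 1 ≤ k → deltaBeta γ Δα k = Δβ k := fun k hk => (h.invariant k hk).symm
  have e₁ : ∀ k, ∑' j, deltaBeta γ Δα (k + 1 + j) = ∑' j, Δβ (k + 1 + j) := fun k =>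
    tsum_congr fun j => e _ (by omega)
  refine ⟨h.alpha_nonneg, fun k hk => e k hk ▸ h.beta_nonneg k hk, fun k _ => rfl, fun k => ?_,
    fun k hk => ?_, fun k hk => ?_, h.at_limit, fun k hk => ?_⟩
  · rw [e (k + 1) (by omega)]; exact h.not_to_a k
  · rw [e k hk, e₁]; exact h.random_vs_deter k hk
  · obtain ⟨k, rfl⟩ : ∃ l, k = l + 1 := ⟨k - 1, by omega⟩
    rw [e₁]; exact h.half_to_a _ hk
  · rw [e k hk, e (k + 1) (by omega)]; exact h.monotone k hk

variable {γ Γ : ℝ} {Δα : ℕ → ℝ}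

theorem FactorLPFeasible.summable_beta (h : FactorLPFeasible γ Γ Δα (deltaBeta γ Δα))
    (hγ₀ : 0 ≤ γ) (hγ₁ : γ ≤ 1) : Summable fun j => deltaBeta γ Δα (1 + j) :=
  Summable.of_nonneg_of_le (fun j => h.beta_nonneg _ (by omega))
    (fun j => by have := h.alpha_nonneg (1 + j) (by omega); simp only [deltaBeta]; linarith)
    (hasSum_deltaX hγ₀ hγ₁).summable

theorem FactorLPFeasible.summable_alpha (h : FactorLPFeasible γ Γ Δα (deltaBeta γ Δα))
    (hγ₀ : 0 ≤ γ) (hγ₁ : γ ≤ 1) : Summable fun j => Δα (1 + j) :=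
  Summable.of_nonneg_of_le (fun j => h.alpha_nonneg _ (by omega))
    (fun j => by
      have := h.beta_nonneg (1 + j) (by omega); simp only [deltaBeta] at this; linarith)
    (hasSum_deltaX hγ₀ hγ₁).summable

theorem FactorLPFeasible.headSum_alpha_add_beta (h : FactorLPFeasible γ Γ Δα (deltaBeta γ Δα))
    (hγ₀ : 0 ≤ γ) (hγ₁ : γ ≤ 1) (k : ℕ∞) :
    headSum Δα k + headSum (deltaBeta γ Δα) k = headSum (deltaX γ) k := by
  rw [← headSum_add (h.summable_alpha hγ₀ hγ₁) (h.summable_beta hγ₀ hγ₁)]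
  congr 1
  ext l
  simp [deltaBeta]

theorem FactorLPFeasible.headSum_alpha_top_le (h : FactorLPFeasible γ Γ Δα (deltaBeta γ Δα)) :
    Γ ≤ headSum Δα ⊤ := headSum_top Δα ▸ h.at_limit

theorem FactorLPFeasible.le_headSum_add_two_mul (h : FactorLPFeasible γ Γ Δα (deltaBeta γ Δα))
    (n : ℕ) : Γ ≤ headSum Δα n + 2 * deltaBeta γ Δα (n + 1) :=
  headSum_natCast Δα n ▸ h.not_to_a n

theorem FactorLPFeasible.le_headSum_add_tailSum (h : FactorLPFeasible γ Γ Δα (deltaBeta γ Δα))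
    (n : ℕ) : Γ ≤ headSum Δα (n + 1 : ℕ) + tailSum (deltaBeta γ Δα) n := by
  rw [headSum_natCast, tailSum_natCast]
  exact h.half_to_a (n + 1) (by omega)

/-- By `random_vs_deter` the first term of the tail dominates the rest. Integrated, this compares a
deterministic assignment with twice a semi-assignment to the same advertiser. -/
theorem FactorLPFeasible.tailSum_le_two_mul (h : FactorLPFeasible γ Γ Δα (deltaBeta γ Δα))
    (hγ₀ : 0 ≤ γ) (hγ₁ : γ ≤ 1) (n : ℕ) :
    tailSum (deltaBeta γ Δα) n ≤ 2 * deltaBeta γ Δα (n + 1) := by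
  have := h.random_vs_deter (n + 1) (by omega)
  rw [tailSum_natCast_eq_add (h.summable_beta hγ₀ hγ₁), tailSum_natCast]
  linarith

theorem FactorLPFeasible.beta_succ_antitone (h : FactorLPFeasible γ Γ Δα (deltaBeta γ Δα)) :
    Antitone fun n : ℕ => deltaBeta γ Δα (n + 1) :=
  antitone_nat_of_succ_le fun n => h.monotone (n + 1) (by omega)

theorem headSum_le_top {f : ℕ → ℝ} (hs : Summable fun j => f (1 + j))
    (hf : ∀ k, 1 ≤ k → 0 ≤ f k) (k : ℕ∞) : headSum f k ≤ headSum f ⊤ := by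
  linarith [headSum_add_tailSum hs k, tailSum_nonneg hf k]

theorem tailSum_le_headSum_top {f : ℕ → ℝ} (hs : Summable fun j => f (1 + j))
    (hf : ∀ k, 1 ≤ k → 0 ≤ f k) (k : ℕ∞) : tailSum f k ≤ headSum f ⊤ := by
  linarith [headSum_add_tailSum hs k, headSum_nonneg hf k]

/-! ### Scanning the circle -/

theorem measurableSet_arc (B y z : ℝ) : MeasurableSet (arc B y z) := by
  unfold arc
  split_ifs
  exacts [measurableSet_Ico, measurableSet_Ico.union measurableSet_Ico]

theorem arc_subset_Ico {B y z : ℝ} (hy : y ∈ Ico 0 B) (hz : z ∈ Ico 0 B) :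
    arc B y z ⊆ Ico 0 B := by
  unfold arc
  split_ifs with h
  · exact Ico_subset_Ico hy.1 hz.2.le
  · exact union_subset (Ico_subset_Ico_left hy.1) (Ico_subset_Ico_right hz.2.le)

theorem volume_real_Ico_diff_ne_top (u v : ℝ) (Y : Set ℝ) : volume (Ico u v \ Y) ≠ ⊤ :=
  measure_ne_top_of_subset sdiff_subset measure_Ico_lt_top.ne

/-- The measure of a growing interval without a fixed set takes all intermediate values. -/
theorem exists_volume_real_Ico_diff_eq {u v b : ℝ} (Y : Set ℝ) (huv : u ≤ v) (hb : 0 ≤ b)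
    (hbv : b < volume.real (Ico u v \ Y)) :
    ∃ z ∈ Ico u v, volume.real (Ico u z \ Y) = b := by
  have hmono : ∀ z z', z ≤ z' → volume.real (Ico u z \ Y) ≤ volume.real (Ico u z' \ Y) :=
    fun z z' h => measureReal_mono (sdiff_subset_sdiff_left (Ico_subset_Ico_right h))
      (volume_real_Ico_diff_ne_top _ _ _)
  have hadd : ∀ z z', z ≤ z' →
      volume.real (Ico u z' \ Y) ≤ volume.real (Ico u z \ Y) + (z' - z) := by
    intro z z' h
    calc volume.real (Ico u z' \ Y) ≤ volume.real ((Ico u z \ Y) ∪ Ico z z') := by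
          refine measureReal_mono (fun x hx => ?_)
            (measure_union_lt_top (volume_real_Ico_diff_ne_top _ _ _).lt_top
              measure_Ico_lt_top).ne
          by_cases hxz : x < z
          · exact Or.inl ⟨⟨hx.1.1, hxz⟩, hx.2⟩
          · exact Or.inr ⟨not_lt.1 hxz, hx.1.2⟩
      _ ≤ volume.real (Ico u z \ Y) + volume.real (Ico z z') := measureReal_union_le _ _
      _ = _ := by rw [Real.volume_real_Ico_of_le h]
  -- Monotone with increments at most the length of the step, hence 1-Lipschitz; measurability of
  -- `Y` plays no role.
  have hcont : Continuous fun z => volume.real (Ico u z \ Y) := by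
    refine (LipschitzWith.of_le_add fun z z' => ?_ : LipschitzWith 1 _).continuous
    rcases le_total z z' with h | h
    · exact (hmono _ _ h).trans (le_add_of_nonneg_right dist_nonneg)
    · rw [Real.dist_eq, abs_of_nonneg (sub_nonneg.2 h)]
      exact hadd _ _ h
  obtain ⟨z, hz, hzb⟩ := intermediate_value_Icc huv hcont.continuousOn
    (show b ∈ Icc _ _ from ⟨by simpa using hb, hbv.le⟩)
  -- The strict inequality in `hbv` excludes the right endpoint; this keeps scan endpoints inside
  -- the half-open interval.
  refine ⟨z, ⟨hz.1, lt_of_le_of_ne hz.2 ?_⟩, hzb⟩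
  rintro rfl
  exact hbv.ne' hzb

/-- Either `b` is used up within `[y, B)`, or the scan wraps and the remainder is found in `[0, y)`.
In the wrapped case `z < y` must be strict, because `arc B y y` is empty rather than the whole
circle. -/
theorem exists_volume_real_arc_diff_eq {B y b : ℝ} {Y : Set ℝ} (hY : MeasurableSet Y)
    (hYB : Y ⊆ Ico 0 B) (hy : y ∈ Ico 0 B) (hb : 0 ≤ b) (hbB : b < B - volume.real Y) :
    ∃ z ∈ Ico 0 B, volume.real (arc B y z \ Y) = b := by
  have hsplit : ∀ z, z ≤ y → volume.real ((Ico y B ∪ Ico 0 z) \ Y) =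
      volume.real (Ico y B \ Y) + volume.real (Ico 0 z \ Y) := by
    intro z hz
    rw [union_sdiff_distrib]
    refine measureReal_union ?_ (measurableSet_Ico.diff hY) (volume_real_Ico_diff_ne_top _ _ _)
      (volume_real_Ico_diff_ne_top _ _ _)
    refine disjoint_left.2 fun x hx hx' => ?_
    linarith [hx.1.1, hx'.1.2]
  by_cases h : b < volume.real (Ico y B \ Y)
  · obtain ⟨z, hz, hzb⟩ := exists_volume_real_Ico_diff_eq Y hy.2.le hb h
    exact ⟨z, ⟨hy.1.trans hz.1, hz.2⟩, by rwa [arc, if_pos hz.1]⟩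
  · have htot : volume.real (Ico y B \ Y) + volume.real (Ico 0 y \ Y) = B - volume.real Y := by
      rw [← hsplit y le_rfl, union_comm, Ico_union_Ico_eq_Ico hy.1 hy.2.le,
        measureReal_sdiff hYB hY measure_Ico_lt_top.ne, Real.volume_real_Ico_of_le (hy.1.trans hy.2.le), sub_zero]
    obtain ⟨z, hz, hzb⟩ := exists_volume_real_Ico_diff_eq (u := 0) (v := y)
      (b := b - volume.real (Ico y B \ Y)) Y hy.1 (by linarith) (by linarith)
    refine ⟨z, ⟨hz.1, hz.2.trans hy.2⟩, ?_⟩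
    rw [arc, if_neg (not_le.2 hz.2), hsplit z hz.2.le, hzb]
    ring

section

variable {B y b : ℝ} {Y : Set ℝ}

theorem oplus_spec (hY : MeasurableSet Y) (hYB : Y ⊆ Ico 0 B) (hy : y ∈ Ico 0 B) (hb : 0 ≤ b)
    (hbB : b < B - volume.real Y) :
    oplus B Y y b ∈ Ico 0 B ∧ volume.real (arc B y (oplus B Y y b) \ Y) = b := by
  rw [oplus, if_pos hbB]
  exact Classical.epsilon_spec (p := fun z => z ∈ Ico 0 B ∧ volume.real (arc B y z \ Y) = b)
    (exists_volume_real_arc_diff_eq hY hYB hy hb hbB)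

theorem oplus_mem_Ico (hY : MeasurableSet Y) (hYB : Y ⊆ Ico 0 B) (hy : y ∈ Ico 0 B)
    (hb : 0 ≤ b) : oplus B Y y b ∈ Ico 0 B := by
  by_cases h : b < B - volume.real Y
  · exact (oplus_spec hY hYB hy hb h).1
  · rwa [oplus, if_neg h]

/-- The three possible shapes of the scanned subset. -/
theorem panSubset_cases (B : ℝ) (Y : Set ℝ) (y b : ℝ) :
    (y ≤ oplus B Y y b ∧ panSubset B Y y b = Ico y (oplus B Y y b) \ Y) ∨
      (oplus B Y y b < y ∧ panSubset B Y y b = (Ico y B ∪ Ico 0 (oplus B Y y b)) \ Y) ∨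
      (oplus B Y y b = y ∧ panSubset B Y y b = Ico 0 B \ Y) := by
  by_cases h : b < B - volume.real Y
  · rw [panSubset, if_pos h, arc]
    by_cases hz : y ≤ oplus B Y y b
    · exact Or.inl ⟨hz, by rw [if_pos hz]⟩
    · exact Or.inr (Or.inl ⟨not_le.1 hz, by rw [if_neg hz]⟩)
  · exact Or.inr (Or.inr ⟨by rw [oplus, if_neg h], by rw [panSubset, if_neg h]⟩)

theorem measurableSet_panSubset (hY : MeasurableSet Y) (y b : ℝ) :
    MeasurableSet (panSubset B Y y b) := by
  unfold panSubset
  split_ifs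
  exacts [(measurableSet_arc _ _ _).diff hY, measurableSet_Ico.diff hY]

theorem panSubset_subset (hY : MeasurableSet Y) (hYB : Y ⊆ Ico 0 B) (hy : y ∈ Ico 0 B)
    (hb : 0 ≤ b) : panSubset B Y y b ⊆ Ico 0 B \ Y := by
  unfold panSubset
  split_ifs
  exacts [sdiff_subset_sdiff_left (arc_subset_Ico hy (oplus_mem_Ico hY hYB hy hb)), subset_rfl]

theorem volume_real_panSubset_le (hY : MeasurableSet Y) (hYB : Y ⊆ Ico 0 B) (hy : y ∈ Ico 0 B)
    (hb : 0 ≤ b) : volume.real (panSubset B Y y b) ≤ b := by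
  by_cases h : b < B - volume.real Y
  · rw [panSubset, if_pos h, (oplus_spec hY hYB hy hb h).2]
  · rw [panSubset, if_neg h, measureReal_sdiff hYB hY measure_Ico_lt_top.ne,
      Real.volume_real_Ico_of_le (hy.1.trans hy.2.le)]
    linarith

theorem volume_real_panSubset_eq_or (hY : MeasurableSet Y) (hYB : Y ⊆ Ico 0 B)
    (hy : y ∈ Ico 0 B) (hb : 0 ≤ b) :
    volume.real (panSubset B Y y b) = b ∨ panSubset B Y y b = Ico 0 B \ Y := by
  by_cases h : b < B - volume.real Y
  · rw [panSubset, if_pos h]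
    exact Or.inl (oplus_spec hY hYB hy hb h).2
  · exact Or.inr (by rw [panSubset, if_neg h])

/-- The scan wraps around only after exhausting the points from the start point on. -/
theorem mem_panSubset_of_lt {x x' : ℝ} (hx : x ∈ panSubset B Y y b) (hxy : x < y)
    (hx' : x' ∈ Ico y B \ Y) (hy : 0 ≤ y) : x' ∈ panSubset B Y y b := by
  rcases panSubset_cases B Y y b with ⟨_, h⟩ | ⟨_, h⟩ | ⟨_, h⟩
  · rw [h] at hx
    exact absurd hx.1.1 (not_le.2 hxy)
  · rw [h]
    exact ⟨Or.inl hx'.1, hx'.2⟩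
  · rw [h]
    exact ⟨⟨hy.trans hx'.1.1, hx'.1.2⟩, hx'.2⟩

end

/-! ### The panoramic invariant of a single advertiser -/

/-- The points assigned deterministically, for a counter function `k`. -/
def topSet (B : ℝ) (k : ℝ → ℕ∞) : Set ℝ := {y | y ∈ Ico 0 B ∧ k y = ⊤}

/-- Apart from the points assigned deterministically, the counter is `m + 1` before the start
point `s` and `m` from there on. -/
structure IsPanoramic (B : ℝ) (k : ℝ → ℕ∞) (s : ℝ) : Prop where
  start_mem : s ∈ Ico 0 B
  measurable : Measurable k
  levels : ∃ m : ℕ, ∀ y ∈ Ico 0 B, k y = ⊤ ∨ (y < s ∧ k y = (m + 1 : ℕ)) ∨ (s ≤ y ∧ k y = m)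

theorem topSet_subset (B : ℝ) (k : ℝ → ℕ∞) : topSet B k ⊆ Ico 0 B := fun _ h => h.1

theorem measurableSet_topSet (B : ℝ) {k : ℝ → ℕ∞} (hk : Measurable k) :
    MeasurableSet (topSet B k) :=
  measurableSet_Ico.inter (hk (measurableSet_singleton ⊤))

theorem notMem_topSet {B y : ℝ} {k : ℝ → ℕ∞} {n : ℕ} (h : k y = n) : y ∉ topSet B k :=
  fun ht => ENat.top_ne_natCast n (ht.2.symm.trans h)

namespace IsPanoramic

variable {B s b : ℝ} {k : ℝ → ℕ∞}

theorem zero (hB : 0 < B) : IsPanoramic B (fun _ => 0) 0 :=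
  ⟨⟨le_rfl, hB⟩, measurable_const, 0, fun _ hy => Or.inr (Or.inr ⟨hy.1, rfl⟩)⟩

theorem measurableSet_panSubset (h : IsPanoramic B k s) (b : ℝ) :
    MeasurableSet (panSubset B (topSet B k) s b) :=
  AdWords.measurableSet_panSubset (measurableSet_topSet B h.measurable) _ _

theorem panSubset_subset (h : IsPanoramic B k s) (hb : 0 ≤ b) :
    panSubset B (topSet B k) s b ⊆ Ico 0 B \ topSet B k :=
  AdWords.panSubset_subset (measurableSet_topSet B h.measurable) (topSet_subset B k)
    h.start_mem hb

theorem ne_top_of_mem (h : IsPanoramic B k s) (hb : 0 ≤ b) {y : ℝ}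
    (hy : y ∈ panSubset B (topSet B k) s b) : k y ≠ ⊤ := fun hk =>
  (h.panSubset_subset hb hy).2 ⟨(h.panSubset_subset hb hy).1, hk⟩

theorem oplus_mem (h : IsPanoramic B k s) (hb : 0 ≤ b) :
    oplus B (topSet B k) s b ∈ Ico 0 B :=
  oplus_mem_Ico (measurableSet_topSet B h.measurable) (topSet_subset B k) h.start_mem hb

/-- Finite counters differ by at most one. -/
theorem le_add_one (h : IsPanoramic B k s) {y y' : ℝ} (hy : y ∈ Ico 0 B) (hy' : y' ∈ Ico 0 B)
    (hk : k y ≠ ⊤) : k y ≤ k y' + 1 := by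
  have hcast : ∀ i j : ℕ, i ≤ j + 1 → (i : ℕ∞) ≤ j + 1 := fun _ _ hij => by exact_mod_cast hij
  obtain ⟨m, hm⟩ := h.levels
  rcases hm y' hy' with h' | ⟨_, h'⟩ | ⟨_, h'⟩
  · simp [h']
  all_goals
    rcases hm y hy with h₁ | ⟨_, h₁⟩ | ⟨_, h₁⟩
    · exact absurd h₁ hk
    all_goals
      rw [h₁, h']
      exact hcast _ _ (by omega)

/-- The scanned subset contains the points with the lowest counters. -/
theorem mem_of_lt (h : IsPanoramic B k s) (hb : 0 ≤ b) {y y' : ℝ}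
    (hy : y ∈ panSubset B (topSet B k) s b) (hy' : y' ∈ Ico 0 B) (hlt : k y' < k y) :
    y' ∈ panSubset B (topSet B k) s b := by
  obtain ⟨m, hm⟩ := h.levels
  have hys := h.panSubset_subset hb hy
  have hmem : y' ∉ topSet B k := fun ht => by simp [ht.2] at hlt
  -- With only the levels `m + 1` before `s` and `m` from `s` on, a strict inequality of finite
  -- counters fixes the sides. Thus the scan reached `y` by wrapping around, after passing `y'`.
  have key : y < s ∧ s ≤ y' := by
    rcases hm y' hy' with h' | ⟨h₂, h'⟩ | ⟨h₂, h'⟩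
    · exact absurd ⟨hy', h'⟩ hmem
    all_goals
      rcases hm y hys.1 with h₁ | ⟨h₃, h₁⟩ | ⟨h₃, h₁⟩
      · exact absurd h₁ (h.ne_top_of_mem hb hy)
      all_goals
        rw [h₁, h', Nat.cast_lt] at hlt
        first
          | omega
          | exact ⟨h₃, h₂⟩
  exact mem_panSubset_of_lt hy key.1 ⟨⟨key.2, hy'.2⟩, hmem⟩ h.start_mem.1

theorem update_measurable {P : Set ℝ} [DecidablePred (· ∈ P)] (hk : Measurable k)
    (hP : MeasurableSet P) (g : ℕ∞ → ℕ∞) : Measurable fun y => if y ∈ P then g (k y) else k y :=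
  Measurable.ite hP ((Measurable.of_discrete (f := g)).comp hk) hk

-- Raising the scanned arc moves the boundary between the two levels from the old start point to the
-- new one. If the scan wraps or goes once around, the lower level itself rises to `m + 1`.
open Classical in
theorem semi (h : IsPanoramic B k s) (hb : 0 ≤ b) :
    IsPanoramic B (fun y => if y ∈ panSubset B (topSet B k) s b then k y + 1 else k y)
      (oplus B (topSet B k) s b) := by
  refine ⟨h.oplus_mem hb, update_measurable h.measurable (h.measurableSet_panSubset b) (· + 1), ?_⟩
  obtain ⟨m, hm⟩ := h.levels
  set z := oplus B (topSet B k) s b with hz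
  rcases panSubset_cases B (topSet B k) s b with ⟨hsz, hP⟩ | ⟨hsz, hP⟩ | ⟨hsz, hP⟩
  · refine ⟨m, fun y hy => ?_⟩
    rw [← hz] at hsz hP
    rw [hP]
    rcases hm y hy with h₁ | ⟨h₃, h₁⟩ | ⟨h₃, h₁⟩
    · simp [h₁]
    · right; left
      rw [if_neg fun hh => absurd hh.1.1 (not_le.2 h₃)]
      exact ⟨h₃.trans_le hsz, h₁⟩
    · by_cases hyz : y < z
      · right; left
        rw [if_pos ⟨⟨h₃, hyz⟩, notMem_topSet h₁⟩, h₁]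
        exact ⟨hyz, by norm_cast⟩
      · right; right
        rw [if_neg fun hh => hyz hh.1.2]
        exact ⟨not_lt.1 hyz, h₁⟩
  -- Wrapped scan: `[s, B)` rises from `m` to `m + 1` and `[0, z)` from `m + 1` to `m + 2`, while
  -- `[z, s)` stays at `m + 1`.
  · refine ⟨m + 1, fun y hy => ?_⟩
    rw [← hz] at hsz hP
    rw [hP]
    rcases hm y hy with h₁ | ⟨h₃, h₁⟩ | ⟨h₃, h₁⟩
    · simp [h₁]
    · by_cases hyz : y < z
      · right; left
        rw [if_pos ⟨Or.inr ⟨hy.1, hyz⟩, notMem_topSet h₁⟩, h₁]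
        exact ⟨hyz, by norm_cast⟩
      · right; right
        rw [if_neg fun hh => hh.1.elim (fun h' => absurd h'.1 (not_le.2 h₃)) fun h' => hyz h'.2]
        exact ⟨not_lt.1 hyz, h₁⟩
    · right; right
      rw [if_pos ⟨Or.inl ⟨h₃, hy.2⟩, notMem_topSet h₁⟩, h₁]
      exact ⟨hsz.le.trans h₃, by norm_cast⟩
  · refine ⟨m + 1, fun y hy => ?_⟩
    rw [← hz] at hsz
    rw [hP, hsz]
    rcases hm y hy with h₁ | ⟨h₃, h₁⟩ | ⟨h₃, h₁⟩
    · simp [h₁]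
    · right; left
      rw [if_pos ⟨hy, notMem_topSet h₁⟩, h₁]
      exact ⟨h₃, by norm_cast⟩
    · right; right
      rw [if_pos ⟨hy, notMem_topSet h₁⟩, h₁]
      exact ⟨h₃, by norm_cast⟩

-- The scanned points leave the level structure, so moving the start point past them creates no
-- violation.
open Classical in
theorem det (h : IsPanoramic B k s) (hb : 0 ≤ b) :
    IsPanoramic B (fun y => if y ∈ panSubset B (topSet B k) s b then ⊤ else k y)
      (oplus B (topSet B k) s b) := by
  refine ⟨h.oplus_mem hb,
    update_measurable h.measurable (h.measurableSet_panSubset b) (fun _ => ⊤), ?_⟩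
  obtain ⟨m, hm⟩ := h.levels
  set z := oplus B (topSet B k) s b with hz
  rcases panSubset_cases B (topSet B k) s b with ⟨hsz, hP⟩ | ⟨hsz, hP⟩ | ⟨hsz, hP⟩
  · refine ⟨m, fun y hy => ?_⟩
    rw [← hz] at hsz hP
    by_cases hyP : y ∈ panSubset B (topSet B k) s b
    · simp [hyP]
    rw [if_neg hyP]
    rw [hP] at hyP
    rcases hm y hy with h₁ | ⟨h₃, h₁⟩ | ⟨h₃, h₁⟩
    · exact Or.inl h₁
    · exact Or.inr (Or.inl ⟨h₃.trans_le hsz, h₁⟩)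
    · refine Or.inr (Or.inr ⟨not_lt.1 fun hyz => hyP ⟨⟨h₃, hyz⟩, notMem_topSet h₁⟩, h₁⟩)
  -- After a wrapped scan no finite point remains at level `m`; those left have level `m + 1` and
  -- lie in `[z, s)`.
  · refine ⟨m + 1, fun y hy => ?_⟩
    rw [← hz] at hsz hP
    by_cases hyP : y ∈ panSubset B (topSet B k) s b
    · simp [hyP]
    rw [if_neg hyP]
    rw [hP] at hyP
    rcases hm y hy with h₁ | ⟨h₃, h₁⟩ | ⟨h₃, h₁⟩
    · exact Or.inl h₁
    · refine Or.inr (Or.inr ⟨not_lt.1 fun hyz => hyP ⟨Or.inr ⟨hy.1, hyz⟩, notMem_topSet h₁⟩, h₁⟩)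
    · refine absurd ⟨Or.inl ⟨h₃, hy.2⟩, notMem_topSet h₁⟩ hyP
  -- After a full turn every point is at `⊤`, so the witness is arbitrary.
  · refine ⟨m, fun y hy => Or.inl ?_⟩
    rw [hP]
    by_cases ht : y ∈ topSet B k
    · simp [ht.2]
    · rw [if_pos ⟨hy, ht⟩]

end IsPanoramic

/-! ### The states of the algorithm -/

section

variable {A : Type*} {B : A → ℝ} {γ Γ : ℝ} {Δα : ℕ → ℝ} {T : ArgmaxRule A} {st : State A}
  {b : A → ℝ}

/-- All advertisers satisfy the panoramic invariant. -/
def State.IsValid (B : A → ℝ) (st : State A) : Prop := ∀ a, IsPanoramic (B a) (st.k a) (st.start a)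

theorem State.subset_def (B : A → ℝ) (st : State A) (b : A → ℝ) (a : A) :
    st.subset B b a = panSubset (B a) (topSet (B a) (st.k a)) (st.start a) (b a) := rfl

theorem State.nextStart_def (B : A → ℝ) (st : State A) (b : A → ℝ) (a : A) :
    st.nextStart B b a = oplus (B a) (topSet (B a) (st.k a)) (st.start a) (b a) := rfl

theorem State.isValid_init (hB : ∀ a, 0 < B a) : (State.init A).IsValid B := fun a =>
  IsPanoramic.zero (hB a)

theorem step_of_randomized {a₁ a₂ : A} (h : decision B γ Δα T st b = .randomized a₁ a₂) :
    step B γ Δα T st b =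
      { k := fun a y => open Classical in
          if (a = a₁ ∨ a = a₂) ∧ y ∈ st.subset B b a then st.k a y + 1 else st.k a y
        start := fun a => open Classical in
          if a = a₁ ∨ a = a₂ then st.nextStart B b a else st.start a
        semi := st.semi ++ [st.pair B b a₁ a₂]
        arrived := st.arrived ++ [b] } := by
  simp only [step, h]

theorem step_of_deterministic {d : A} (h : decision B γ Δα T st b = .deterministic d) :
    step B γ Δα T st b =
      { k := fun a y => open Classical in
          if a = d ∧ y ∈ st.subset B b a then ⊤ else st.k a y
        start := fun a => open Classical in if a = d then st.nextStart B b a else st.start a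
        semi := st.semi
        arrived := st.arrived ++ [b] } := by
  simp only [step, h]

theorem State.IsValid.step (h : st.IsValid B) (hb : ∀ a, 0 ≤ b a) :
    (step B γ Δα T st b).IsValid B := by
  classical
  intro a
  cases hd : decision B γ Δα T st b with
  | randomized a₁ a₂ =>
    rw [step_of_randomized hd]
    by_cases ha : a = a₁ ∨ a = a₂
    · simpa [ha, State.subset_def, State.nextStart_def] using (h a).semi (hb a)
    · simpa [ha] using h a
  | deterministic d =>
    rw [step_of_deterministic hd]
    by_cases ha : a = d
    · simpa [ha, State.subset_def, State.nextStart_def] using (h d).det (hb d)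
    · simpa [ha] using h a

theorem runState_append_singleton (I : List (A → ℝ)) :
    runState B γ Δα T (I ++ [b]) = AdWords.step B γ Δα T (runState B γ Δα T I) b := by
  simp [runState]

theorem runState_take_succ (I : List (A → ℝ)) {t : ℕ} (ht : t < I.length) :
    runState B γ Δα T (I.take (t + 1)) =
      AdWords.step B γ Δα T (runState B γ Δα T (I.take t)) I[t] := by
  rw [← List.take_concat_get ht, List.concat_eq_append, runState_append_singleton]

theorem isValid_runState (hB : ∀ a, 0 < B a) (I : List (A → ℝ)) (hI : ∀ b ∈ I, ∀ a, 0 ≤ b a) :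
    (runState B γ Δα T I).IsValid B := by
  induction I using List.reverseRecOn with
  | nil => exact State.isValid_init hB
  | append_singleton I b ih =>
    rw [runState_append_singleton]
    exact (ih fun b' hb' => hI b' (by simp [hb'])).step (hI b (by simp))

/-! ### Integrals of functions of the counters -/

theorem integrableOn_comp_counter {k : ℝ → ℕ∞} (hk : Measurable k) {f : ℕ∞ → ℝ} {C : ℝ}
    (hf : ∀ n, |f n| ≤ C) {Y : Set ℝ} (hY : volume Y ≠ ⊤) :
    IntegrableOn (fun y => f (k y)) Y :=
  Measure.integrableOn_of_bounded (M := C) hY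
    ((Measurable.of_discrete (f := f)).comp hk).aestronglyMeasurable
    (Filter.Eventually.of_forall fun y => hf (k y))

end

/-! ### The dual variable of a round -/

section

variable {A : Type*} {B : A → ℝ} {γ Γ : ℝ} {Δα : ℕ → ℝ} {T : ArgmaxRule A} {st : State A}
  {b : A → ℝ}

/-- The dual variable set in the round in which an impression with bids `b` arrives. -/
noncomputable def dualBeta (B : A → ℝ) (γ : ℝ) (Δα : ℕ → ℝ) (T : ArgmaxRule A) (st : State A)
    (b : A → ℝ) : ℝ :=
  match decision B γ Δα T st b with
  | .randomized a₁ a₂ => deltaR B γ Δα st b a₁ + deltaR B γ Δα st b a₂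
  | .deterministic d => deltaD B γ Δα st b d

theorem betaVar_eq_dualBeta (I : List (A → ℝ)) (i : Fin I.length) :
    betaVar B γ Δα T I i = dualBeta B γ Δα T (runState B γ Δα T (I.take i)) (I.get i) := rfl

theorem FactorLPFeasible.abs_beta_succ_le (h : FactorLPFeasible γ Γ Δα (deltaBeta γ Δα))
    (hγ₀ : 0 ≤ γ) (hγ₁ : γ ≤ 1) (n : ℕ) :
    |deltaBeta γ Δα (n + 1)| ≤ headSum (deltaBeta γ Δα) ⊤ := by
  rw [abs_of_nonneg (h.beta_nonneg _ (by omega))]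
  have h₁ := tailSum_natCast_eq_add (h.summable_beta hγ₀ hγ₁) n
  have h₂ := tailSum_nonneg h.beta_nonneg (n + 1 : ℕ)
  have h₃ := tailSum_le_headSum_top (h.summable_beta hγ₀ hγ₁) h.beta_nonneg n
  linarith

theorem FactorLPFeasible.abs_tailSum_le (h : FactorLPFeasible γ Γ Δα (deltaBeta γ Δα))
    (hγ₀ : 0 ≤ γ) (hγ₁ : γ ≤ 1) (k : ℕ∞) :
    |tailSum (deltaBeta γ Δα) k| ≤ headSum (deltaBeta γ Δα) ⊤ := by
  rw [abs_of_nonneg (tailSum_nonneg h.beta_nonneg k)]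
  exact tailSum_le_headSum_top (h.summable_beta hγ₀ hγ₁) h.beta_nonneg k

theorem abs_headSum_le {f : ℕ → ℝ} (hs : Summable fun j => f (1 + j))
    (hf : ∀ k, 1 ≤ k → 0 ≤ f k) (k : ℕ∞) : |headSum f k| ≤ headSum f ⊤ := by
  rw [abs_of_nonneg (headSum_nonneg hf k)]
  exact headSum_le_top hs hf k

theorem FactorLPFeasible.integrableOn_beta (h : FactorLPFeasible γ Γ Δα (deltaBeta γ Δα))
    (hγ₀ : 0 ≤ γ) (hγ₁ : γ ≤ 1) {k : ℝ → ℕ∞} (hk : Measurable k) {Y : Set ℝ}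
    (hY : volume Y ≠ ⊤) : IntegrableOn (fun y => deltaBeta γ Δα ((k y).toNat + 1)) Y :=
  integrableOn_comp_counter hk (f := fun n => deltaBeta γ Δα (n.toNat + 1))
    (fun _ => h.abs_beta_succ_le hγ₀ hγ₁ _) hY

theorem FactorLPFeasible.integrableOn_tailSum (h : FactorLPFeasible γ Γ Δα (deltaBeta γ Δα))
    (hγ₀ : 0 ≤ γ) (hγ₁ : γ ≤ 1) {k : ℝ → ℕ∞} (hk : Measurable k) {Y : Set ℝ}
    (hY : volume Y ≠ ⊤) : IntegrableOn (fun y => tailSum (deltaBeta γ Δα) (k y)) Y :=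
  integrableOn_comp_counter hk (h.abs_tailSum_le hγ₀ hγ₁) hY

theorem integrableOn_headSum {f : ℕ → ℝ} (hs : Summable fun j => f (1 + j))
    (hf : ∀ k, 1 ≤ k → 0 ≤ f k) {k : ℝ → ℕ∞} (hk : Measurable k) {Y : Set ℝ}
    (hY : volume Y ≠ ⊤) : IntegrableOn (fun y => headSum f (k y)) Y :=
  integrableOn_comp_counter hk (abs_headSum_le hs hf) hY

theorem State.IsValid.measurableSet_subset (hst : st.IsValid B) (b : A → ℝ) (a : A) :
    MeasurableSet (st.subset B b a) := (hst a).measurableSet_panSubset (b a)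

theorem State.IsValid.subset_Ico (hst : st.IsValid B) (hb : ∀ a, 0 ≤ b a) (a : A) :
    st.subset B b a ⊆ Ico 0 (B a) := fun _ hy => ((hst a).panSubset_subset (hb a) hy).1

theorem State.IsValid.ne_top_of_mem (hst : st.IsValid B) (hb : ∀ a, 0 ≤ b a) {a : A} {y : ℝ}
    (hy : y ∈ st.subset B b a) : st.k a y ≠ ⊤ := (hst a).ne_top_of_mem (hb a) hy

theorem volume_ne_top_of_subset_Ico {B : ℝ} {Y : Set ℝ} (h : Y ⊆ Ico 0 B) : volume Y ≠ ⊤ :=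
  measure_ne_top_of_subset h measure_Ico_lt_top.ne

theorem deltaR_nonneg (h : FactorLPFeasible γ Γ Δα (deltaBeta γ Δα)) (a : A) :
    0 ≤ deltaR B γ Δα st b a :=
  integral_nonneg fun _ => h.beta_nonneg _ (by omega)

theorem deltaD_nonneg (h : FactorLPFeasible γ Γ Δα (deltaBeta γ Δα)) (a : A) :
    0 ≤ deltaD B γ Δα st b a :=
  integral_nonneg fun _ => tailSum_nonneg h.beta_nonneg _

theorem deltaD_le_two_mul_deltaR (h : FactorLPFeasible γ Γ Δα (deltaBeta γ Δα))
    (hγ₀ : 0 ≤ γ) (hγ₁ : γ ≤ 1) (hst : st.IsValid B) (hb : ∀ a, 0 ≤ b a) (a : A) :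
    deltaD B γ Δα st b a ≤ 2 * deltaR B γ Δα st b a := by
  have hfin := volume_ne_top_of_subset_Ico (hst.subset_Ico hb a)
  rw [deltaD, deltaR, ← integral_const_mul]
  refine setIntegral_mono_on (h.integrableOn_tailSum hγ₀ hγ₁ (hst a).measurable hfin)
    ((h.integrableOn_beta hγ₀ hγ₁ (hst a).measurable hfin).const_mul 2)
    (hst.measurableSet_subset b a) fun y hy => ?_
  have := h.tailSum_le_two_mul hγ₀ hγ₁ (st.k a y).toNat
  rwa [ENat.natCast_toNat (hst.ne_top_of_mem hb hy)] at this

theorem decision_randomized {a₁ a₂ : A} (hd : decision B γ Δα T st b = .randomized a₁ a₂) :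
    a₁ ≠ a₂ ∧
      (∀ a, deltaD B γ Δα st b a ≤ deltaR B γ Δα st b a₁ + deltaR B γ Δα st b a₂) ∧
      ∀ a, a ≠ a₁ → a ≠ a₂ →
        2 * deltaR B γ Δα st b a ≤ deltaR B γ Δα st b a₁ + deltaR B γ Δα st b a₂ := by
  rw [decision] at hd
  split_ifs at hd with hle
  cases hd
  refine ⟨T.topTwo_ne _ _, fun a => (T.le_top _ _ a).trans hle, fun a h₁ h₂ => ?_⟩
  have := T.le_topTwo _ _ a h₁ h₂
  linarith [this.1, this.2]

/-- Let `r` be the top two for `deltaR`. The branch condition says that their sum is less than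
`deltaD` of `d`, and `deltaD` of `d` is at most twice its `deltaR`. Hence `d` belongs to the top
two, the other member has `deltaR` below half of `deltaD` of `d`, and it dominates every `a ≠ d`. -/
theorem decision_deterministic (h : FactorLPFeasible γ Γ Δα (deltaBeta γ Δα))
    (hγ₀ : 0 ≤ γ) (hγ₁ : γ ≤ 1) (hst : st.IsValid B) (hb : ∀ a, 0 ≤ b a) {d : A}
    (hd : decision B γ Δα T st b = .deterministic d) :
    (∀ a, deltaD B γ Δα st b a ≤ deltaD B γ Δα st b d) ∧
      ∀ a, a ≠ d → 2 * deltaR B γ Δα st b a ≤ deltaD B γ Δα st b d := by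
  rw [decision] at hd
  split_ifs at hd with hle
  rw [Decision.deterministic.injEq] at hd
  rw [not_le, hd] at hle
  refine ⟨fun a => hd ▸ T.le_top _ _ a, fun a ha => ?_⟩
  have h2 := deltaD_le_two_mul_deltaR h hγ₀ hγ₁ hst hb d
  have htop := T.le_topTwo (st.arrived ++ [b]) (deltaR B γ Δα st b)
  set r := T.topTwo (st.arrived ++ [b]) (deltaR B γ Δα st b)
  by_cases hd₁ : d = r.1
  · subst hd₁
    have : deltaR B γ Δα st b a ≤ deltaR B γ Δα st b r.2 := by
      by_cases ha₂ : a = r.2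
      · rw [ha₂]
      · exact (htop a ha ha₂).2
    linarith
  · by_cases hd₂ : d = r.2
    · subst hd₂
      have : deltaR B γ Δα st b a ≤ deltaR B γ Δα st b r.1 := by
        by_cases ha₁ : a = r.1
        · rw [ha₁]
        · exact (htop a ha₁ ha).1
      linarith
    · have := htop d hd₁ hd₂
      linarith [this.1, this.2]

theorem deltaD_le_dualBeta (h : FactorLPFeasible γ Γ Δα (deltaBeta γ Δα))
    (hγ₀ : 0 ≤ γ) (hγ₁ : γ ≤ 1) (hst : st.IsValid B) (hb : ∀ a, 0 ≤ b a) (a : A) :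
    deltaD B γ Δα st b a ≤ dualBeta B γ Δα T st b := by
  unfold dualBeta
  cases hd : decision B γ Δα T st b with
  | randomized a₁ a₂ => exact (decision_randomized hd).2.1 a
  | deterministic d => exact (decision_deterministic h hγ₀ hγ₁ hst hb hd).1 a

theorem dualBeta_nonneg (h : FactorLPFeasible γ Γ Δα (deltaBeta γ Δα)) :
    0 ≤ dualBeta B γ Δα T st b := by
  unfold dualBeta
  cases decision B γ Δα T st b with
  | randomized a₁ a₂ => exact add_nonneg (deltaR_nonneg h _) (deltaR_nonneg h _)
  | deterministic d => exact deltaD_nonneg h _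

/-- The effect of a round on a single advertiser. -/
theorem step_cases (h : FactorLPFeasible γ Γ Δα (deltaBeta γ Δα))
    (hγ₀ : 0 ≤ γ) (hγ₁ : γ ≤ 1) (hst : st.IsValid B) (hb : ∀ a, 0 ≤ b a) (a : A) :
    ((step B γ Δα T st b).k a = st.k a ∧
        2 * deltaR B γ Δα st b a ≤ dualBeta B γ Δα T st b) ∨
      ((∀ y ∈ st.subset B b a, (step B γ Δα T st b).k a y = st.k a y + 1) ∧
        ∀ y ∉ st.subset B b a, (step B γ Δα T st b).k a y = st.k a y) ∨
      ((∀ y ∈ st.subset B b a, (step B γ Δα T st b).k a y = ⊤) ∧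
        ∀ y ∉ st.subset B b a, (step B γ Δα T st b).k a y = st.k a y) := by
  classical
  unfold dualBeta
  cases hd : decision B γ Δα T st b with
  | randomized a₁ a₂ =>
    rw [step_of_randomized hd]
    by_cases ha : a = a₁ ∨ a = a₂
    · exact Or.inr (Or.inl ⟨fun y hy => if_pos ⟨ha, hy⟩, fun y hy => if_neg fun h' => hy h'.2⟩)
    · refine Or.inl ⟨funext fun y => if_neg fun h' => ha h'.1, ?_⟩
      rw [not_or] at ha
      exact (decision_randomized hd).2.2 a ha.1 ha.2
  | deterministic d =>
    rw [step_of_deterministic hd]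
    by_cases ha : a = d
    · exact Or.inr (Or.inr ⟨fun y hy => if_pos ⟨ha, hy⟩, fun y hy => if_neg fun h' => hy h'.2⟩)
    · exact Or.inl ⟨funext fun y => if_neg fun h' => ha h'.1,
        (decision_deterministic h hγ₀ hγ₁ hst hb hd).2 a ha⟩

end

/-! ### The history of a single advertiser -/

/-- The rounds `0, …, n - 1` as seen by one advertiser: counters `k t` and start points `s t`
before round `t`, bids `b t` and dual variables `β t`. In round `t` the advertiser is passed over,
is semi-assigned the scanned subset, or is assigned the scanned subset deterministically. -/
structure CounterHistory (n : ℕ) (B : ℝ) (Δβ : ℕ → ℝ) (k : ℕ → ℝ → ℕ∞) (s b β : ℕ → ℝ)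
    (Y : ℕ → Set ℝ) (none semi det : ℕ → Prop) : Prop where
  subset_eq : ∀ t < n, Y t = panSubset B (topSet B (k t)) (s t) (b t)
  panoramic : ∀ t ≤ n, IsPanoramic B (k t) (s t)
  bid_nonneg : ∀ t < n, 0 ≤ b t
  deter_le : ∀ t < n, ∫ y in Y t, tailSum Δβ (k t y) ≤ β t
  kind : ∀ t < n, none t ∨ semi t ∨ det t
  of_none : ∀ t < n, none t →
    k (t + 1) = k t ∧ 2 * ∫ y in Y t, Δβ ((k t y).toNat + 1) ≤ β t
  of_semi : ∀ t < n, semi t →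
    (∀ y ∈ Y t, k (t + 1) y = k t y + 1) ∧ ∀ y ∉ Y t, k (t + 1) y = k t y
  of_det : ∀ t < n, det t → (∀ y ∈ Y t, k (t + 1) y = ⊤) ∧ ∀ y ∉ Y t, k (t + 1) y = k t y

namespace CounterHistory

variable {n : ℕ} {B γ Γ : ℝ} {Δα Δβ : ℕ → ℝ} {k : ℕ → ℝ → ℕ∞} {s b β : ℕ → ℝ} {Y : ℕ → Set ℝ}
  {none semi det : ℕ → Prop}

theorem measurableSet (h : CounterHistory n B Δβ k s b β Y none semi det) {t : ℕ} (ht : t < n) :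
    MeasurableSet (Y t) :=
  h.subset_eq t ht ▸ (h.panoramic t ht.le).measurableSet_panSubset (b t)

theorem subset_diff (h : CounterHistory n B Δβ k s b β Y none semi det) {t : ℕ} (ht : t < n) :
    Y t ⊆ Ico 0 B \ topSet B (k t) :=
  h.subset_eq t ht ▸ (h.panoramic t ht.le).panSubset_subset (h.bid_nonneg t ht)

theorem subset_Ico (h : CounterHistory n B Δβ k s b β Y none semi det) {t : ℕ} (ht : t < n) :
    Y t ⊆ Ico 0 B := fun _ hy => (h.subset_diff ht hy).1

theorem ne_top_of_mem (h : CounterHistory n B Δβ k s b β Y none semi det) {t : ℕ} (ht : t < n)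
    {y : ℝ} (hy : y ∈ Y t) : k t y ≠ ⊤ := fun hk =>
  (h.subset_diff ht hy).2 ⟨h.subset_Ico ht hy, hk⟩

theorem mem_of_lt (h : CounterHistory n B Δβ k s b β Y none semi det) {t : ℕ} (ht : t < n)
    {y y' : ℝ} (hy : y ∈ Y t) (hy' : y' ∈ Ico 0 B) (hlt : k t y' < k t y) : y' ∈ Y t := by
  rw [h.subset_eq t ht] at hy ⊢
  exact (h.panoramic t ht.le).mem_of_lt (h.bid_nonneg t ht) hy hy' hlt

theorem volume_eq_or (h : CounterHistory n B Δβ k s b β Y none semi det) {t : ℕ} (ht : t < n) :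
    volume.real (Y t) = b t ∨ Y t = Ico 0 B \ topSet B (k t) := by
  have hp := h.panoramic t ht.le
  rw [h.subset_eq t ht]
  exact volume_real_panSubset_eq_or (measurableSet_topSet B hp.measurable) (topSet_subset B _)
    hp.start_mem (h.bid_nonneg t ht)

theorem le_succ (h : CounterHistory n B Δβ k s b β Y none semi det) {t : ℕ} (ht : t < n)
    (y : ℝ) : k t y ≤ k (t + 1) y := by
  rcases h.kind t ht with hn | hs | hd
  · rw [(h.of_none t ht hn).1]
  · by_cases hy : y ∈ Y t
    · rw [(h.of_semi t ht hs).1 y hy]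
      exact le_self_add
    · rw [(h.of_semi t ht hs).2 y hy]
  · by_cases hy : y ∈ Y t
    · rw [(h.of_det t ht hd).1 y hy]
      exact le_top
    · rw [(h.of_det t ht hd).2 y hy]

theorem mono (h : CounterHistory n B Δβ k s b β Y none semi det) {t t' : ℕ} (htt' : t ≤ t')
    (ht' : t' ≤ n) (y : ℝ) : k t y ≤ k t' y := by
  induction t', htt' using Nat.le_induction with
  | base => exact le_rfl
  | succ j _ ih => exact (ih (by omega)).trans (h.le_succ (by omega) y)

theorem add_one_le_of_mem (h : CounterHistory n B Δβ k s b β Y none semi det) {t : ℕ}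
    (ht : t < n) (hkind : semi t ∨ det t) {y : ℝ} (hy : y ∈ Y t) : k t y + 1 ≤ k (t + 1) y := by
  rcases hkind with hs | hd
  · rw [(h.of_semi t ht hs).1 y hy]
  · rw [(h.of_det t ht hd).1 y hy]
    exact le_top

/-- Scanned points have a counter at most the final counter of any remaining point. -/
theorem le_of_mem (h : CounterHistory n B Δβ k s b β Y none semi det) {t : ℕ} (ht : t < n)
    (hkind : semi t ∨ det t) {y y₀ : ℝ} (hy : y ∈ Y t) (hy₀ : y₀ ∈ Ico 0 B) :
    k t y ≤ k n y₀ := by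
  by_cases hmem : y₀ ∈ Y t
  · exact ((h.panoramic t ht.le).le_add_one (h.subset_Ico ht hy) hy₀
      (h.ne_top_of_mem ht hy)).trans
      ((h.add_one_le_of_mem ht hkind hmem).trans (h.mono ht le_rfl y₀))
  · by_contra! hlt
    exact hmem (h.mem_of_lt ht hy hy₀ ((h.mono ht.le le_rfl y₀).trans_lt hlt))

/-- A point semi-assigned at the lowest final level `m` remains at level `m + 1`. -/
theorem final_eq_of_mem (h : CounterHistory n B Δβ k s b β Y none semi det) {t m : ℕ}
    (ht : t < n) (hs : semi t) {y y₀ : ℝ} (hy : y ∈ Y t) (hk : k t y = m) (hy₀ : y₀ ∈ Ico 0 B)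
    (hm : k n y₀ = m) : k n y = (m + 1 : ℕ) := by
  have key : ∀ j, t + 1 ≤ j → j ≤ n → k j y = (m + 1 : ℕ) := by
    intro j hj
    induction j, hj using Nat.le_induction with
    | base =>
      intro _
      rw [(h.of_semi t ht hs).1 y hy, hk, Nat.cast_add, Nat.cast_one]
    | succ j hj ih =>
      intro hjn
      have hkj := ih (by omega)
      -- Points scanned in an effective round have counter at most the final counter `m` of `y₀`, so
      -- a point already at `m + 1` is never touched again.
      have hnot : semi j ∨ det j → y ∉ Y j := fun hkind hyj => by
        have := h.le_of_mem (by omega) hkind hyj hy₀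
        rw [hkj, hm, Nat.cast_le] at this
        omega
      rcases h.kind j (by omega) with hn' | hs' | hd'
      · rw [(h.of_none j (by omega) hn').1, hkj]
      · rw [(h.of_semi j (by omega) hs').2 y (hnot (Or.inl hs')), hkj]
      · rw [(h.of_det j (by omega) hd').2 y (hnot (Or.inr hd')), hkj]
  exact key n ht le_rfl

/-- A semi-assignment lifts a point from `m` to `m + 1` and counters never decrease, so no later
round meets it at `m`. -/
theorem disjoint_of_semi (h : CounterHistory n B Δβ k s b β Y none semi det) {t t' : ℕ} (m : ℕ)
    (htt' : t < t') (ht' : t' < n) (hs : semi t) :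
    Disjoint {y ∈ Y t | k t y = m} {y ∈ Y t' | k t' y = m} := by
  refine disjoint_left.2 fun y hy hy' => ?_
  have h₁ := h.mono (t := t + 1) htt' ht'.le y
  rw [(h.of_semi t (by omega) hs).1 y hy.1, hy.2, hy'.2] at h₁
  norm_cast at h₁
  omega

theorem subset_topSet_of_det (h : CounterHistory n B Δβ k s b β Y none semi det) {t t' : ℕ}
    (htt' : t < t') (ht' : t' ≤ n) (hd : det t) : Y t ⊆ topSet B (k t') := fun y hy => by
  refine ⟨h.subset_Ico (by omega) hy, top_le_iff.1 ?_⟩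
  rw [← (h.of_det t (by omega) hd).1 y hy]
  exact h.mono htt' ht' y

theorem disjoint_of_det (h : CounterHistory n B Δβ k s b β Y none semi det) {t t' : ℕ}
    (htt' : t < t') (ht' : t' < n) (hd : det t) : Disjoint (Y t) (Y t') :=
  disjoint_left.2 fun _ hy hy' =>
    (h.subset_diff ht' hy').2 (h.subset_topSet_of_det htt' ht'.le hd hy)

end CounterHistory

/-- Two-valued lower bound, `c` off `E` and `d` on `E`. It is written as a main term minus a
correction so that the two can be summed over rounds separately. -/
theorem le_setIntegral_of_le {Y E : Set ℝ} {f : ℝ → ℝ} {c d : ℝ} (hY : MeasurableSet Y)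
    (hE : MeasurableSet E) (hEY : E ⊆ Y) (hfin : volume Y ≠ ⊤) (hf : IntegrableOn f Y)
    (hc : ∀ y ∈ Y \ E, c ≤ f y) (hd : ∀ y ∈ E, d ≤ f y) :
    c * volume.real Y - (c - d) * volume.real E ≤ ∫ y in Y, f y := by
  have hEfin : volume E ≠ ⊤ := measure_ne_top_of_subset hEY hfin
  have h₁ : c * volume.real (Y \ E) ≤ ∫ y in Y \ E, f y :=
    setIntegral_ge_of_const_le_real (hY.diff hE)
      (measure_ne_top_of_subset sdiff_subset hfin) hc (hf.mono_set sdiff_subset)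
  have h₂ : d * volume.real E ≤ ∫ y in E, f y :=
    setIntegral_ge_of_const_le_real hE hEfin hd (hf.mono_set hEY)
  rw [measureReal_sdiff hEY hE hfin] at h₁
  have h₃ := setIntegral_sdiff hE hf hEY
  linarith

/-! ### Lower bounds for the dual variables and the covering argument -/

namespace CounterHistory

variable {n : ℕ} {B γ Γ : ℝ} {Δα : ℕ → ℝ} {k : ℕ → ℝ → ℕ∞} {s b β : ℕ → ℝ} {Y : ℕ → Set ℝ}
  {none semi det : ℕ → Prop}

/-- Here `x` and `x'` bound the shortfall of `α` below `Γ` per point on the two finite levels;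
`at_limit` rules out a shortfall at `⊤`. -/
theorem headSum_alpha_ge (h : CounterHistory n B (deltaBeta γ Δα) k s b β Y none semi det)
    (hLP : FactorLPFeasible γ Γ Δα (deltaBeta γ Δα)) (hγ₀ : 0 ≤ γ) (hγ₁ : γ ≤ 1) (hB : 0 ≤ B)
    {m : ℕ} {x x' : ℝ} (hx : Γ - headSum Δα m ≤ x) (hx' : Γ - headSum Δα (m + 1 : ℕ) ≤ x')
    (hlev : ∀ y ∈ Ico 0 B, k n y = ⊤ ∨ k n y = m ∨ k n y = (m + 1 : ℕ)) :
    Γ * B - x * volume.real {y ∈ Ico 0 B | k n y = m}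
      - x' * volume.real {y ∈ Ico 0 B | k n y = (m + 1 : ℕ)} ≤
      ∫ y in Ico 0 B, headSum Δα (k n y) := by
  have hk := (h.panoramic n le_rfl).measurable
  have hmeas : ∀ j : ℕ, MeasurableSet {y ∈ Ico 0 B | k n y = j} := fun j =>
    measurableSet_Ico.inter (hk (measurableSet_singleton (j : ℕ∞)))
  set F := {y ∈ Ico 0 B | k n y = m} with hF
  set F' := {y ∈ Ico 0 B | k n y = (m + 1 : ℕ)} with hF'
  have hint : ∀ Z ⊆ Ico 0 B, IntegrableOn (fun y => headSum Δα (k n y)) Z := fun Z hZ =>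
    integrableOn_headSum (hLP.summable_alpha hγ₀ hγ₁) hLP.alpha_nonneg hk
      (volume_ne_top_of_subset_Ico hZ)
  have hF'sub : F' ⊆ Ico 0 B := fun _ hy => hy.1
  have hFsub : F ⊆ Ico 0 B \ F' := fun y hy => ⟨hy.1, fun hy' => by
    have h₁ := hy'.2
    rw [hy.2, Nat.cast_inj] at h₁
    omega⟩
  have h₁ : Γ * volume.real (Ico 0 B \ F') - (Γ - (Γ - x)) * volume.real F ≤
      ∫ y in Ico 0 B \ F', headSum Δα (k n y) := by
    refine le_setIntegral_of_le (measurableSet_Ico.diff (hmeas _)) (hmeas _) hFsub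
      (volume_ne_top_of_subset_Ico sdiff_subset) (hint _ sdiff_subset) (fun y hy => ?_)
      fun y hy => ?_
    · rcases hlev y hy.1.1 with h' | h' | h'
      · rw [h']
        exact hLP.headSum_alpha_top_le
      · exact absurd ⟨hy.1.1, h'⟩ hy.2
      · exact absurd ⟨hy.1.1, h'⟩ hy.1.2
    · rw [hy.2]
      linarith
  have h₂ : (Γ - x') * volume.real F' ≤ ∫ y in F', headSum Δα (k n y) := by
    refine setIntegral_ge_of_const_le_real (hmeas _) (volume_ne_top_of_subset_Ico hF'sub)
      (fun y hy => ?_) (hint _ hF'sub)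
    rw [hy.2]
    linarith
  have h₃ := setIntegral_sdiff (hmeas (m + 1)) (hint _ subset_rfl) hF'sub
  rw [measureReal_sdiff hF'sub (hmeas _) measure_Ico_lt_top.ne, Real.volume_real_Ico_of_le hB]
    at h₁
  linarith

/-- A semi-assignment scans only counters up to the final minimum `m`. Below `m` the constraint
`half_to_a` at `m` yields the larger value, and at `m` the same constraint at `m + 1` yields the
smaller one. Only the deterministic alternative `deter_le` is used to bound `β`. -/
theorem beta_ge_of_semi (h : CounterHistory n B (deltaBeta γ Δα) k s b β Y none semi det)
    (hLP : FactorLPFeasible γ Γ Δα (deltaBeta γ Δα)) (hγ₀ : 0 ≤ γ) (hγ₁ : γ ≤ 1)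
    {m : ℕ} {y₀ : ℝ} (hy₀ : y₀ ∈ Ico 0 B) (hm : k n y₀ = m) {t : ℕ} (ht : t < n) (hs : semi t) :
    max (Γ - headSum Δα m) 0 * volume.real (Y t) -
      (max (Γ - headSum Δα m) 0 - max (Γ - headSum Δα (m + 1 : ℕ)) 0) *
        volume.real {y ∈ Y t | k t y = m} ≤ β t := by
  have hk := (h.panoramic t ht.le).measurable
  have hfin := volume_ne_top_of_subset_Ico (h.subset_Ico ht)
  have hle : ∀ y ∈ Y t, k t y ≤ m := fun y hy => hm ▸ h.le_of_mem ht (Or.inl hs) hy hy₀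
  refine (le_setIntegral_of_le (h.measurableSet ht)
    ((h.measurableSet ht).inter (hk (measurableSet_singleton (m : ℕ∞)))) (fun _ hy => hy.1) hfin
    (hLP.integrableOn_tailSum hγ₀ hγ₁ hk hfin) (fun y hy => ?_) fun y hy => ?_).trans
    (h.deter_le t ht)
  · refine max_le ?_ (tailSum_nonneg hLP.beta_nonneg _)
    obtain ⟨j, hj⟩ := ENat.ne_top_iff_exists.1 (h.ne_top_of_mem ht hy.1)
    have hjm : j < m := by
      have h₁ : k t y < m := lt_of_le_of_ne (hle y hy.1) fun h' => hy.2 ⟨hy.1, h'⟩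
      rwa [← hj, Nat.cast_lt] at h₁
    obtain ⟨i, rfl⟩ : ∃ i, m = i + 1 := ⟨m - 1, by omega⟩
    rw [← hj]
    have h₂ := hLP.le_headSum_add_tailSum i
    have h₃ := tailSum_natCast_antitone (hLP.summable_beta hγ₀ hγ₁) hLP.beta_nonneg
      (show j ≤ i by omega)
    simp only at h₃
    linarith
  · refine max_le ?_ (tailSum_nonneg hLP.beta_nonneg _)
    have h₁ : k t y = m := hy.2
    rw [h₁]
    have h₂ := hLP.le_headSum_add_tailSum m
    linarith

/-- When passed over, the advertiser may have scanned counters up to `m + 1`, one more than in a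
semi-assigned round. Monotonicity of `Δβ` and `not_to_a` at `m` settle counters up to `m`;
`not_to_a` at `m + 1` settles the critical part. -/
theorem beta_ge_of_none (h : CounterHistory n B (deltaBeta γ Δα) k s b β Y none semi det)
    (hLP : FactorLPFeasible γ Γ Δα (deltaBeta γ Δα)) (hγ₀ : 0 ≤ γ) (hγ₁ : γ ≤ 1)
    {m : ℕ} {y₀ : ℝ} (hy₀ : y₀ ∈ Ico 0 B) (hm : k n y₀ = m) {t : ℕ} (ht : t < n) (hn : none t) :
    max (Γ - headSum Δα m) 0 * volume.real (Y t) -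
      (max (Γ - headSum Δα m) 0 - max (Γ - headSum Δα (m + 1 : ℕ)) 0) *
        volume.real {y ∈ Y t | k t y = (m + 1 : ℕ)} ≤ β t := by
  have hk := (h.panoramic t ht.le).measurable
  have hfin := volume_ne_top_of_subset_Ico (h.subset_Ico ht)
  have hle : ∀ y ∈ Y t, k t y ≤ (m + 1 : ℕ) := fun y hy => by
    refine ((h.panoramic t ht.le).le_add_one (h.subset_Ico ht hy) hy₀
      (h.ne_top_of_mem ht hy)).trans ?_
    rw [Nat.cast_add, Nat.cast_one, ← hm]
    gcongr
    exact h.mono ht.le le_rfl y₀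
  have hnn : ∀ y, 0 ≤ 2 * deltaBeta γ Δα ((k t y).toNat + 1) := fun y =>
    mul_nonneg zero_le_two (hLP.beta_nonneg _ (by omega))
  have hβ := (h.of_none t ht hn).2
  rw [← integral_const_mul] at hβ
  refine (le_setIntegral_of_le (h.measurableSet ht)
    ((h.measurableSet ht).inter (hk (measurableSet_singleton ((m + 1 : ℕ) : ℕ∞))))
    (fun _ hy => hy.1) hfin
    ((hLP.integrableOn_beta hγ₀ hγ₁ hk hfin).const_mul 2) (fun y hy => ?_) fun y hy => ?_).trans hβ
  · refine max_le ?_ (hnn y)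
    obtain ⟨j, hj⟩ := ENat.ne_top_iff_exists.1 (h.ne_top_of_mem ht hy.1)
    have hjm : j < m + 1 := by
      have h₁ : k t y < (m + 1 : ℕ) := lt_of_le_of_ne (hle y hy.1) fun h' => hy.2 ⟨hy.1, h'⟩
      rwa [← hj, Nat.cast_lt] at h₁
    rw [← hj, ENat.toNat_natCast]
    have h₂ := hLP.le_headSum_add_two_mul m
    have h₃ := hLP.beta_succ_antitone (show j ≤ m by omega)
    simp only at h₃
    linarith
  · refine max_le ?_ (hnn y)
    have h₁ : k t y = (m + 1 : ℕ) := hy.2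
    rw [h₁, ENat.toNat_natCast]
    have h₂ := hLP.le_headSum_add_two_mul (m + 1)
    linarith

theorem beta_nonneg (h : CounterHistory n B (deltaBeta γ Δα) k s b β Y none semi det)
    (hLP : FactorLPFeasible γ Γ Δα (deltaBeta γ Δα)) {t : ℕ} (ht : t < n) : 0 ≤ β t :=
  (integral_nonneg fun _ => tailSum_nonneg hLP.beta_nonneg _).trans (h.deter_le t ht)

/-- A finite disjoint union of sets inside a set of finite measure. -/
theorem sum_volume_real_le {S : Finset ℕ} {Z : ℕ → Set ℝ} {F : Set ℝ} (hF : volume F ≠ ⊤)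
    (hZ : ∀ t ∈ S, MeasurableSet (Z t)) (hZF : ∀ t ∈ S, Z t ⊆ F)
    (hdisj : ∀ t ∈ S, ∀ t' ∈ S, t < t' → Disjoint (Z t) (Z t')) :
    ∑ t ∈ S, volume.real (Z t) ≤ volume.real F := by
  rw [← measureReal_biUnion_finset (fun t ht t' ht' hne => ?_) hZ
    fun t ht => measure_ne_top_of_subset (hZF t ht) hF]
  · exact measureReal_mono (iUnion₂_subset hZF) hF
  · rcases lt_or_gt_of_ne hne with hlt | hlt
    · exact hdisj t ht t' ht' hlt
    · exact (hdisj t' ht' t ht hlt).symm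

-- The heart of dual feasibility: the deficit of `α` splits as `(x - x') * |F| + x' * (|F| + |F'|)`,
-- and `hlow` and `htotal` bound the two measures by what the rounds scan.
open Classical in
theorem payment_le_of_level (h : CounterHistory n B (deltaBeta γ Δα) k s b β Y none semi det)
    (hLP : FactorLPFeasible γ Γ Δα (deltaBeta γ Δα)) (hγ₀ : 0 ≤ γ) (hγ₁ : γ ≤ 1) (hB : 0 ≤ B)
    (hΓ : 0 ≤ Γ) {m : ℕ} {y₀ : ℝ} (hy₀ : y₀ ∈ Ico 0 B) (hm : k n y₀ = m)
    (hmin : ∀ y ∈ Ico 0 B, (m : ℕ∞) ≤ k n y) {S : Finset ℕ} (hS : ∀ t ∈ S, t < n) :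
    Γ * min (∑ t ∈ S, b t) B ≤ (∫ y in Ico 0 B, headSum Δα (k n y)) + ∑ t ∈ S, β t := by
  have hpan := h.panoramic n le_rfl
  have hlev : ∀ y ∈ Ico 0 B, k n y = ⊤ ∨ k n y = m ∨ k n y = (m + 1 : ℕ) := by
    intro y hy
    by_cases htop : k n y = ⊤
    · exact Or.inl htop
    · obtain ⟨j, hj⟩ := ENat.ne_top_iff_exists.1 htop
      have h₁ := hmin y hy
      have h₂ := hpan.le_add_one hy hy₀ htop
      rw [hm] at h₂
      rw [← hj] at h₁ h₂ ⊢
      norm_cast at h₁ h₂ ⊢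
      omega
  -- Truncation at `0` makes `x'` and `x - x'` nonnegative multipliers for the two covering
  -- inequalities.
  set x := max (Γ - headSum Δα m) 0 with hx
  set x' := max (Γ - headSum Δα (m + 1 : ℕ)) 0 with hx'
  have hx'0 : 0 ≤ x' := le_max_right _ _
  have hx'x : x' ≤ x := by
    refine max_le_max ?_ le_rfl
    rw [headSum_natCast_succ]
    linarith [hLP.alpha_nonneg (m + 1) (by omega)]
  have hxΓ : x ≤ Γ := max_le (by linarith [headSum_nonneg hLP.alpha_nonneg (m : ℕ∞)]) hΓ
  have hα := h.headSum_alpha_ge hLP hγ₀ hγ₁ hB (le_max_left _ 0) (le_max_left _ 0) hlev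
  rw [← hx, ← hx'] at hα
  have hmeas : ∀ j : ℕ, MeasurableSet {y ∈ Ico 0 B | k n y = j} := fun j =>
    measurableSet_Ico.inter (hpan.measurable (measurableSet_singleton (j : ℕ∞)))
  set F := {y ∈ Ico 0 B | k n y = m} with hF
  set F' := {y ∈ Ico 0 B | k n y = (m + 1 : ℕ)} with hF'
  have hFfin : volume F ≠ ⊤ := volume_ne_top_of_subset_Ico fun _ hy => hy.1
  have hF'fin : volume F' ≠ ⊤ := volume_ne_top_of_subset_Ico fun _ hy => hy.1
  have hFF' : Disjoint F F' := disjoint_left.2 fun y hy hy' => by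
    have h₁ := hy'.2
    rw [hy.2, Nat.cast_inj] at h₁
    omega
  have hDF : volume.real (topSet B (k n)) + (volume.real F + volume.real F') = B := by
    rw [← measureReal_union hFF' (hmeas _) hFfin hF'fin, ← measureReal_union _
      ((hmeas _).union (hmeas _)) (volume_ne_top_of_subset_Ico (topSet_subset B _))
      (measure_union_lt_top hFfin.lt_top hF'fin.lt_top).ne]
    · have : topSet B (k n) ∪ (F ∪ F') = Ico 0 B := by
        ext y
        constructor
        · rintro (hy | hy | hy)
          exacts [hy.1, hy.1, hy.1]
        · intro hy
          rcases hlev y hy with h' | h' | h'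
          exacts [Or.inl ⟨hy, h'⟩, Or.inr (Or.inl ⟨hy, h'⟩), Or.inr (Or.inr ⟨hy, h'⟩)]
      rw [this, Real.volume_real_Ico_of_le hB, sub_zero]
    · refine disjoint_left.2 fun y hy hy' => ?_
      rcases hy' with hy' | hy' <;> exact notMem_topSet hy'.2 hy
  -- the critical part of each scanned subset
  let E : ℕ → Set ℝ := fun t =>
    if none t then {y ∈ Y t | k t y = (m + 1 : ℕ)} else {y ∈ Y t | k t y = m}
  have hEY : ∀ t, E t ⊆ Y t := fun t => by
    simp only [E]
    split_ifs <;> exact fun _ hy => hy.1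
  have hEmeas : ∀ t < n, MeasurableSet (E t) := fun t ht => by
    have hk := (h.panoramic t ht.le).measurable
    simp only [E]
    split_ifs
    · exact (h.measurableSet ht).inter (hk (measurableSet_singleton ((m + 1 : ℕ) : ℕ∞)))
    · exact (h.measurableSet ht).inter (hk (measurableSet_singleton (m : ℕ∞)))
  -- The kinds of round may overlap, so `D` is defined by complement; its rounds are then
  -- deterministic by `kind`.
  set N := S.filter fun t => none t ∨ semi t with hN
  set D := S.filter fun t => ¬(none t ∨ semi t) with hD
  have hNn : ∀ t ∈ N, t < n := fun t ht => hS t (Finset.mem_filter.1 ht).1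
  have hDn : ∀ t ∈ D, t < n ∧ det t := fun t ht => by
    obtain ⟨htS, hnot⟩ := Finset.mem_filter.1 ht
    refine ⟨hS t htS, ?_⟩
    rcases h.kind t (hS t htS) with h' | h' | h'
    exacts [absurd (Or.inl h') hnot, absurd (Or.inr h') hnot, h']
  have hsplit : ∀ f : ℕ → ℝ, ∑ t ∈ S, f t = ∑ t ∈ N, f t + ∑ t ∈ D, f t := fun f =>
    (Finset.sum_filter_add_sum_filter_not S _ f).symm
  have hgain : x * ∑ t ∈ N, volume.real (Y t) - (x - x') * ∑ t ∈ N, volume.real (E t) ≤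
      ∑ t ∈ S, β t := by
    rw [hsplit, Finset.mul_sum, Finset.mul_sum, ← Finset.sum_sub_distrib]
    refine le_add_of_le_of_nonneg (Finset.sum_le_sum fun t ht => ?_)
      (Finset.sum_nonneg fun t ht => h.beta_nonneg hLP (hDn t ht).1)
    by_cases hn : none t
    · simp only [E, if_pos hn]
      exact h.beta_ge_of_none hLP hγ₀ hγ₁ hy₀ hm (hNn t ht) hn
    · simp only [E, if_neg hn]
      exact h.beta_ge_of_semi hLP hγ₀ hγ₁ hy₀ hm (hNn t ht)
        ((Finset.mem_filter.1 ht).2.resolve_left hn)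
  -- The unused part of the budget. It relaxes both covering inequalities and costs at most `x * u ≤
  -- Γ * u`.
  set u := B - min (∑ t ∈ S, b t) B with hu
  have hu0 : 0 ≤ u := sub_nonneg.2 (min_le_right _ _)
  -- A full scan in `N` contains every finally finite point. Without one, all scanned measures equal
  -- the bids, and those of `D` fit disjointly into the set at `⊤`.
  have htotal : volume.real F + volume.real F' ≤ ∑ t ∈ N, volume.real (Y t) + u := by
    by_cases hfull : ∃ t ∈ N, Y t = Ico 0 B \ topSet B (k t)
    · obtain ⟨t, ht, hYt⟩ := hfull
      have hsub : F ∪ F' ⊆ Y t := by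
        rw [hYt]
        rintro y hy
        have hfinal : y ∈ Ico 0 B ∧ k n y ≠ ⊤ := by
          rcases hy with hy | hy
          all_goals exact ⟨hy.1, fun h' => notMem_topSet hy.2 ⟨hy.1, h'⟩⟩
        exact ⟨hfinal.1, fun hy' => hfinal.2 (top_le_iff.1
          (hy'.2 ▸ h.mono (hNn t ht).le le_rfl y))⟩
      have h₁ := measureReal_mono hsub (volume_ne_top_of_subset_Ico (h.subset_Ico (hNn t ht)))
      rw [measureReal_union hFF' (hmeas _) hFfin hF'fin] at h₁
      have h₂ := Finset.single_le_sum (f := fun t => volume.real (Y t))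
        (fun _ _ => measureReal_nonneg) ht
      linarith
    · push Not at hfull
      have h₁ : ∑ t ∈ N, volume.real (Y t) = ∑ t ∈ N, b t := Finset.sum_congr rfl fun t ht =>
        (h.volume_eq_or (hNn t ht)).resolve_right (hfull t ht)
      -- A full deterministic scan would have put `y₀` at `⊤`.
      have h₂ : ∑ t ∈ D, volume.real (Y t) = ∑ t ∈ D, b t := Finset.sum_congr rfl fun t ht => by
        refine (h.volume_eq_or (hDn t ht).1).resolve_right fun hYt => ?_
        refine notMem_topSet hm (h.subset_topSet_of_det (hDn t ht).1 le_rfl (hDn t ht).2 ?_)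
        rw [hYt]
        exact ⟨hy₀, fun hy' => notMem_topSet hm ⟨hy₀, top_le_iff.1
          (hy'.2 ▸ h.mono (hDn t ht).1.le le_rfl y₀)⟩⟩
      have h₃ : ∑ t ∈ D, volume.real (Y t) ≤ volume.real (topSet B (k n)) :=
        sum_volume_real_le (volume_ne_top_of_subset_Ico (topSet_subset B _))
          (fun t ht => h.measurableSet (hDn t ht).1)
          (fun t ht => h.subset_topSet_of_det (hDn t ht).1 le_rfl (hDn t ht).2)
          fun t ht t' ht' htt' => h.disjoint_of_det htt' (hDn t' ht').1 (hDn t ht).2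
      have h₄ := min_le_left (∑ t ∈ S, b t) B
      have h₅ := hsplit b
      linarith
  -- If a passed-over round scans a point at `m + 1`, it also scans all of `F`, outside its critical
  -- part. Otherwise the nonempty critical parts come from semi-assignments; they are disjoint and
  -- end in `F'`, so subtracting their measure from `htotal` leaves `F`.
  have hlow : volume.real F ≤
      ∑ t ∈ N, volume.real (Y t) - ∑ t ∈ N, volume.real (E t) + u := by
    by_cases hwrap : ∃ t ∈ N, none t ∧ (E t).Nonempty
    · obtain ⟨t, ht, hn, y, hy⟩ := hwrap
      simp only [E, if_pos hn] at hy
      have hsub : F ⊆ Y t \ E t := fun z hz => by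
        have hkz : k t z ≤ m := hz.2 ▸ h.mono (hNn t ht).le le_rfl z
        have hlt : k t z < (m + 1 : ℕ) := hkz.trans_lt (Nat.cast_lt.2 (Nat.lt_succ_self m))
        refine ⟨h.mem_of_lt (hNn t ht) hy.1 hz.1 (hlt.trans_eq hy.2.symm), fun hzE => ?_⟩
        simp only [E, if_pos hn] at hzE
        exact hlt.ne hzE.2
      have hfin := volume_ne_top_of_subset_Ico (h.subset_Ico (hNn t ht))
      have h₁ := measureReal_mono hsub (measure_ne_top_of_subset sdiff_subset hfin)
      rw [measureReal_sdiff (hEY t) (hEmeas t (hNn t ht)) hfin] at h₁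
      have h₂ := Finset.single_le_sum (f := fun t => volume.real (Y t) - volume.real (E t))
        (fun t' ht' => sub_nonneg.2 (measureReal_mono (hEY t')
          (volume_ne_top_of_subset_Ico (h.subset_Ico (hNn t' ht'))))) ht
      rw [Finset.sum_sub_distrib] at h₂
      linarith
    · push Not at hwrap
      have hsemi : ∀ t ∈ N, (E t).Nonempty → ¬none t ∧ semi t := fun t ht hne => by
        have hn : ¬none t := fun hn => hne.ne_empty (hwrap t ht hn)
        exact ⟨hn, (Finset.mem_filter.1 ht).2.resolve_left hn⟩
      have h₁ : ∑ t ∈ N, volume.real (E t) ≤ volume.real F' := by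
        refine sum_volume_real_le hF'fin (fun t ht => hEmeas t (hNn t ht)) (fun t ht y hy => ?_)
          fun t ht t' ht' htt' => disjoint_left.2 fun y hy hy' => ?_
        · obtain ⟨hn, hs⟩ := hsemi t ht ⟨y, hy⟩
          simp only [E, if_neg hn] at hy
          exact ⟨h.subset_Ico (hNn t ht) hy.1,
            h.final_eq_of_mem (hNn t ht) hs hy.1 hy.2 hy₀ hm⟩
        · obtain ⟨hn, hs⟩ := hsemi t ht ⟨y, hy⟩
          obtain ⟨hn', hs'⟩ := hsemi t' ht' ⟨y, hy'⟩
          simp only [E, if_neg hn] at hy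
          simp only [E, if_neg hn'] at hy'
          exact disjoint_left.1 (h.disjoint_of_semi m htt' (hNn t' ht') hs) hy hy'
      linarith
  -- Weighting `hlow` by `x - x'` and `htotal` by `x'` reproduces the lower bound `hgain` on the
  -- right, plus `x * u`.
  have e₁ := mul_le_mul_of_nonneg_left hlow (sub_nonneg.2 hx'x)
  have e₂ := mul_le_mul_of_nonneg_left htotal hx'0
  have e₃ := mul_le_mul_of_nonneg_right hxΓ hu0
  have e₄ : min (∑ t ∈ S, b t) B = B - u := by rw [hu]; ring
  rw [e₄]
  linarith

/-- Approximate dual feasibility for one advertiser. -/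
theorem payment_le (h : CounterHistory n B (deltaBeta γ Δα) k s b β Y none semi det)
    (hLP : FactorLPFeasible γ Γ Δα (deltaBeta γ Δα)) (hγ₀ : 0 ≤ γ) (hγ₁ : γ ≤ 1) (hB : 0 ≤ B)
    {S : Finset ℕ} (hS : ∀ t ∈ S, t < n) :
    Γ * min (∑ t ∈ S, b t) B ≤ (∫ y in Ico 0 B, headSum Δα (k n y)) + ∑ t ∈ S, β t := by
  classical
  have hβ : 0 ≤ ∑ t ∈ S, β t := Finset.sum_nonneg fun t ht => h.beta_nonneg hLP (hS t ht)
  have hpay : 0 ≤ min (∑ t ∈ S, b t) B :=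
    le_min (Finset.sum_nonneg fun t ht => h.bid_nonneg t (hS t ht)) hB
  rcases lt_or_ge Γ 0 with hΓ | hΓ
  -- Feasibility does not force `Γ ≥ 0`; for negative `Γ` the signs suffice.
  · exact (mul_nonpos_of_nonpos_of_nonneg hΓ.le hpay).trans (add_nonneg
      (integral_nonneg fun _ => headSum_nonneg hLP.alpha_nonneg _) hβ)
  by_cases hex : ∃ m : ℕ, ∃ y ∈ Ico 0 B, k n y = m
  · obtain ⟨y₀, hy₀, hm⟩ := Nat.find_spec hex
    refine h.payment_le_of_level hLP hγ₀ hγ₁ hB hΓ hy₀ hm (fun y hy => ?_) hS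
    by_cases htop : k n y = ⊤
    · rw [htop]
      exact le_top
    · obtain ⟨j, hj⟩ := ENat.ne_top_iff_exists.1 htop
      rw [← hj, Nat.cast_le]
      exact Nat.find_min' hex ⟨y, hy, hj.symm⟩
  · have htop : ∀ y ∈ Ico 0 B, k n y = ⊤ := fun y hy => by
      by_contra hne
      obtain ⟨j, hj⟩ := ENat.ne_top_iff_exists.1 hne
      exact hex ⟨j, y, hy, hj.symm⟩
    have h₁ : Γ * volume.real (Ico 0 B) ≤ ∫ y in Ico 0 B, headSum Δα (k n y) :=
      setIntegral_ge_of_const_le_real measurableSet_Ico measure_Ico_lt_top.ne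
        (fun y hy => htop y hy ▸ hLP.headSum_alpha_top_le)
        (integrableOn_headSum (hLP.summable_alpha hγ₀ hγ₁) hLP.alpha_nonneg
          (h.panoramic n le_rfl).measurable measure_Ico_lt_top.ne)
    rw [Real.volume_real_Ico_of_le hB, sub_zero] at h₁
    have h₂ := mul_le_mul_of_nonneg_left (min_le_right (∑ t ∈ S, b t) B) hΓ
    linarith

end CounterHistory

section

variable {A : Type*} {B : A → ℝ} {γ Γ : ℝ} {Δα : ℕ → ℝ} {T : ArgmaxRule A}

/-! ### Approximate dual feasibility -/

/-- The state before the impression with index `t` arrives. -/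
noncomputable def stateAt (B : A → ℝ) (γ : ℝ) (Δα : ℕ → ℝ) (T : ArgmaxRule A)
    (I : List (A → ℝ)) (t : ℕ) : State A := runState B γ Δα T (I.take t)

/-- The bids for the impression with index `t`. -/
def bidsAt (I : List (A → ℝ)) (t : ℕ) : A → ℝ := I.getD t 0

theorem bidsAt_fin (I : List (A → ℝ)) (i : Fin I.length) : bidsAt I i = I.get i := by
  simp [bidsAt]

theorem stateAt_length (I : List (A → ℝ)) :
    stateAt B γ Δα T I I.length = runState B γ Δα T I := by
  rw [stateAt, List.take_length]

theorem stateAt_succ (I : List (A → ℝ)) {t : ℕ} (ht : t < I.length) :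
    stateAt B γ Δα T I (t + 1) = step B γ Δα T (stateAt B γ Δα T I t) (bidsAt I t) := by
  rw [stateAt, runState_take_succ I ht, stateAt, bidsAt, List.getD_eq_getElem _ _ ht]

theorem isValid_stateAt (hB : ∀ a, 0 < B a) {I : List (A → ℝ)} (hI : ∀ b ∈ I, ∀ a, 0 ≤ b a)
    (t : ℕ) : (stateAt B γ Δα T I t).IsValid B :=
  isValid_runState hB _ fun b hb => hI b (List.mem_of_mem_take hb)

theorem bidsAt_nonneg {I : List (A → ℝ)} (hI : ∀ b ∈ I, ∀ a, 0 ≤ b a) {t : ℕ}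
    (ht : t < I.length) (a : A) : 0 ≤ bidsAt I t a := by
  rw [bidsAt, List.getD_eq_getElem _ _ ht]
  exact hI _ (List.getElem_mem ht) a

theorem betaVar_eq (I : List (A → ℝ)) (i : Fin I.length) :
    betaVar B γ Δα T I i = dualBeta B γ Δα T (stateAt B γ Δα T I i) (bidsAt I i) := by
  rw [bidsAt_fin]
  rfl

theorem payment_le_alphaVar_add (hB : ∀ a, 0 < B a) (hγ₀ : 0 ≤ γ) (hγ₁ : γ ≤ 1)
    (hLP : FactorLPFeasible γ Γ Δα (deltaBeta γ Δα)) (I : List (A → ℝ))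
    (hI : ∀ b ∈ I, ∀ a, 0 ≤ b a) (a : A) (S : Finset (Fin I.length)) :
    Γ * payment B I a S ≤ alphaVar B γ Δα T I a + ∑ i ∈ S, betaVar B γ Δα T I i := by
  -- The three kinds of round are taken to be their effects on the counters rather than branches of
  -- `decision`, so all the content lies in `kind`, supplied by `step_cases`.
  have hhist : CounterHistory I.length (B a) (deltaBeta γ Δα)
      (fun t => (stateAt B γ Δα T I t).k a) (fun t => (stateAt B γ Δα T I t).start a)
      (fun t => bidsAt I t a)
      (fun t => dualBeta B γ Δα T (stateAt B γ Δα T I t) (bidsAt I t))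
      (fun t => (stateAt B γ Δα T I t).subset B (bidsAt I t) a)
      (fun t => (stateAt B γ Δα T I (t + 1)).k a = (stateAt B γ Δα T I t).k a ∧
        2 * deltaR B γ Δα (stateAt B γ Δα T I t) (bidsAt I t) a ≤
          dualBeta B γ Δα T (stateAt B γ Δα T I t) (bidsAt I t))
      (fun t => (∀ y ∈ (stateAt B γ Δα T I t).subset B (bidsAt I t) a,
          (stateAt B γ Δα T I (t + 1)).k a y = (stateAt B γ Δα T I t).k a y + 1) ∧
        ∀ y ∉ (stateAt B γ Δα T I t).subset B (bidsAt I t) a,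
          (stateAt B γ Δα T I (t + 1)).k a y = (stateAt B γ Δα T I t).k a y)
      (fun t => (∀ y ∈ (stateAt B γ Δα T I t).subset B (bidsAt I t) a,
          (stateAt B γ Δα T I (t + 1)).k a y = ⊤) ∧
        ∀ y ∉ (stateAt B γ Δα T I t).subset B (bidsAt I t) a,
          (stateAt B γ Δα T I (t + 1)).k a y = (stateAt B γ Δα T I t).k a y) :=
    { subset_eq := fun _ _ => rfl
      panoramic := fun t _ => isValid_stateAt hB hI t a
      bid_nonneg := fun _ ht => bidsAt_nonneg hI ht a
      deter_le := fun t ht => deltaD_le_dualBeta hLP hγ₀ hγ₁ (isValid_stateAt hB hI t)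
        (bidsAt_nonneg hI ht) a
      kind := fun t ht => by
        rw [stateAt_succ I ht]
        exact step_cases hLP hγ₀ hγ₁ (isValid_stateAt hB hI t) (bidsAt_nonneg hI ht) a
      of_none := fun _ _ h => h
      of_semi := fun _ _ h => h
      of_det := fun _ _ h => h }
  have := hhist.payment_le hLP hγ₀ hγ₁ (hB a).le (S := S.map Fin.valEmbedding) fun t ht => by
    obtain ⟨i, _, rfl⟩ := Finset.mem_map.1 ht
    exact i.2
  simp only [Finset.sum_map, Fin.valEmbedding_apply, stateAt_length] at this
  simpa only [payment, alphaVar, betaVar_eq, ← bidsAt_fin] using this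

theorem alphaVar_nonneg (hLP : FactorLPFeasible γ Γ Δα (deltaBeta γ Δα)) (I : List (A → ℝ))
    (a : A) : 0 ≤ alphaVar B γ Δα T I a :=
  integral_nonneg fun _ => headSum_nonneg hLP.alpha_nonneg _

theorem betaVar_nonneg (hLP : FactorLPFeasible γ Γ Δα (deltaBeta γ Δα)) (I : List (A → ℝ))
    (i : Fin I.length) : 0 ≤ betaVar B γ Δα T I i :=
  betaVar_eq_dualBeta (T := T) I i ▸ dualBeta_nonneg hLP

theorem approxDualFeasible (hB : ∀ a, 0 < B a) (hγ₀ : 0 ≤ γ) (hγ₁ : γ ≤ 1)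
    (hLP : FactorLPFeasible γ Γ Δα (deltaBeta γ Δα)) (I : List (A → ℝ))
    (hI : ∀ b ∈ I, ∀ a, 0 ≤ b a) :
    ApproxDualFeasible B Γ I (alphaVar B γ Δα T I) (betaVar B γ Δα T I) :=
  ⟨alphaVar_nonneg hLP I, betaVar_nonneg hLP I, payment_le_alphaVar_add hB hγ₀ hγ₁ hLP I hI⟩

/-! ### The sum of the dual variables `β` -/

theorem setIntegral_sub_setIntegral {f g : ℝ → ℝ} {Z Y : Set ℝ} (hZ : MeasurableSet Z)
    (hY : MeasurableSet Y) (hYZ : Y ⊆ Z) (hf : IntegrableOn f Z) (hg : IntegrableOn g Z)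
    (hfg : ∀ y ∈ Z \ Y, f y = g y) :
    ∫ y in Z, f y = (∫ y in Z, g y) + ∫ y in Y, (f y - g y) := by
  rw [integral_sub (hf.mono_set hYZ) (hg.mono_set hYZ)]
  have h₁ := setIntegral_sdiff hY hf hYZ
  have h₂ := setIntegral_sdiff hY hg hYZ
  rw [setIntegral_congr_fun (hZ.diff hY) hfg] at h₁
  linarith

/-- The share of `β` collected in one round on the points of a single advertiser. -/
theorem integral_headSum_beta_step (hγ₀ : 0 ≤ γ) (hγ₁ : γ ≤ 1)
    (hLP : FactorLPFeasible γ Γ Δα (deltaBeta γ Δα)) {st : State A} (hst : st.IsValid B)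
    {b : A → ℝ} (hb : ∀ a, 0 ≤ b a) (a : A) {k' : ℝ → ℕ∞} (hk' : Measurable k')
    (hout : ∀ y ∉ st.subset B b a, k' y = st.k a y) :
    ((∀ y ∈ st.subset B b a, k' y = st.k a y + 1) →
      ∫ y in Ico 0 (B a), headSum (deltaBeta γ Δα) (k' y) =
        (∫ y in Ico 0 (B a), headSum (deltaBeta γ Δα) (st.k a y)) + deltaR B γ Δα st b a) ∧
    ((∀ y ∈ st.subset B b a, k' y = ⊤) →
      ∫ y in Ico 0 (B a), headSum (deltaBeta γ Δα) (k' y) =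
        (∫ y in Ico 0 (B a), headSum (deltaBeta γ Δα) (st.k a y)) + deltaD B γ Δα st b a) := by
  have hs := hLP.summable_beta hγ₀ hγ₁
  have hint : ∀ {κ : ℝ → ℕ∞}, Measurable κ →
      IntegrableOn (fun y => headSum (deltaBeta γ Δα) (κ y)) (Ico 0 (B a)) := fun hκ =>
    integrableOn_headSum hs hLP.beta_nonneg hκ measure_Ico_lt_top.ne
  have key := setIntegral_sub_setIntegral measurableSet_Ico (hst.measurableSet_subset b a)
    (hst.subset_Ico hb a) (hint hk') (hint (hst a).measurable)
    fun y hy => by rw [hout y hy.2]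
  constructor <;> intro hin <;> rw [key] <;> congr 1
  · refine setIntegral_congr_fun (hst.measurableSet_subset b a) fun y hy => ?_
    obtain ⟨j, hj⟩ := ENat.ne_top_iff_exists.1 (hst.ne_top_of_mem hb hy)
    simp only [hin y hy, ← hj, ENat.toNat_natCast]
    rw [← Nat.cast_add_one, headSum_natCast_succ]
    ring
  · refine setIntegral_congr_fun (hst.measurableSet_subset b a) fun y hy => ?_
    simp only [hin y hy, ← headSum_add_tailSum hs (st.k a y)]
    ring

/-- The integrated `Δβ` charge is a potential whose increase in a round is that round's `β`: a
semi-assignment adds the next increment, a deterministic assignment the whole tail. -/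
theorem sum_integral_headSum_beta_step [Fintype A] (hγ₀ : 0 ≤ γ) (hγ₁ : γ ≤ 1)
    (hLP : FactorLPFeasible γ Γ Δα (deltaBeta γ Δα)) {st : State A} (hst : st.IsValid B)
    {b : A → ℝ} (hb : ∀ a, 0 ≤ b a) :
    ∑ a, ∫ y in Ico 0 (B a), headSum (deltaBeta γ Δα) ((step B γ Δα T st b).k a y) =
      (∑ a, ∫ y in Ico 0 (B a), headSum (deltaBeta γ Δα) (st.k a y)) +
        dualBeta B γ Δα T st b := by
  classical
  have hmeas : ∀ a, Measurable ((step B γ Δα T st b).k a) := fun a => (hst.step hb a).measurable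
  cases hd : decision B γ Δα T st b with
  | randomized a₁ a₂ =>
    have hterm : ∀ a, ∫ y in Ico 0 (B a), headSum (deltaBeta γ Δα) ((step B γ Δα T st b).k a y) =
        (∫ y in Ico 0 (B a), headSum (deltaBeta γ Δα) (st.k a y)) +
          ((if a = a₁ then deltaR B γ Δα st b a else 0) +
            if a = a₂ then deltaR B γ Δα st b a else 0) := by
      intro a
      have hka : (step B γ Δα T st b).k a = fun y =>
          if (a = a₁ ∨ a = a₂) ∧ y ∈ st.subset B b a then st.k a y + 1 else st.k a y := by
        rw [step_of_randomized hd]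
      by_cases ha : a = a₁ ∨ a = a₂
      · rw [(integral_headSum_beta_step hγ₀ hγ₁ hLP hst hb a (hmeas a)
          (fun y hy => by simp [hka, hy])).1 fun y hy => by simp [hka, ha, hy]]
        congr 1
        -- Distinctness of `a₁` and `a₂` ensures that exactly one of the two indicators is active.
        have hne := (decision_randomized hd).1
        rcases ha with rfl | rfl
        · simp [hne]
        · simp [hne.symm]
      · rw [show (step B γ Δα T st b).k a = st.k a by simp [hka, ha]]
        rw [not_or] at ha
        simp [ha.1, ha.2]
    rw [Finset.sum_congr rfl fun a _ => hterm a, Finset.sum_add_distrib, Finset.sum_add_distrib]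
    simp [dualBeta, hd]
  | deterministic d =>
    have hterm : ∀ a, ∫ y in Ico 0 (B a), headSum (deltaBeta γ Δα) ((step B γ Δα T st b).k a y) =
        (∫ y in Ico 0 (B a), headSum (deltaBeta γ Δα) (st.k a y)) +
          (if a = d then deltaD B γ Δα st b a else 0) := by
      intro a
      have hka : (step B γ Δα T st b).k a = fun y =>
          if a = d ∧ y ∈ st.subset B b a then ⊤ else st.k a y := by
        rw [step_of_deterministic hd]
      by_cases ha : a = d
      · rw [(integral_headSum_beta_step hγ₀ hγ₁ hLP hst hb a (hmeas a)
          (fun y hy => by simp [hka, hy])).2 fun y hy => by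
            rw [hka]
            exact if_pos ⟨ha, hy⟩, if_pos ha]
      · rw [show (step B γ Δα T st b).k a = st.k a by simp [hka, ha], if_neg ha, add_zero]
    rw [Finset.sum_congr rfl fun a _ => hterm a, Finset.sum_add_distrib]
    simp [dualBeta, hd]

theorem sum_betaVar [Fintype A] (hB : ∀ a, 0 < B a) (hγ₀ : 0 ≤ γ) (hγ₁ : γ ≤ 1)
    (hLP : FactorLPFeasible γ Γ Δα (deltaBeta γ Δα)) (I : List (A → ℝ))
    (hI : ∀ b ∈ I, ∀ a, 0 ≤ b a) :
    ∑ i, betaVar B γ Δα T I i =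
      ∑ a, ∫ y in Ico 0 (B a), headSum (deltaBeta γ Δα) ((runState B γ Δα T I).k a y) := by
  simp only [betaVar_eq]
  rw [Fin.sum_univ_eq_sum_range
    (fun t => dualBeta B γ Δα T (stateAt B γ Δα T I t) (bidsAt I t)) I.length,
    ← stateAt_length I]
  have key : ∀ t ≤ I.length,
      ∑ j ∈ Finset.range t, dualBeta B γ Δα T (stateAt B γ Δα T I j) (bidsAt I j) =
        ∑ a, ∫ y in Ico 0 (B a), headSum (deltaBeta γ Δα) ((stateAt B γ Δα T I t).k a y) := by
    intro t
    induction t with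
    | zero => simp [stateAt, runState, State.init, headSum_zero]
    | succ t ih =>
      intro ht
      rw [Finset.sum_range_succ, ih (by omega), stateAt_succ I ht,
        sum_integral_headSum_beta_step hγ₀ hγ₁ hLP (isValid_stateAt hB hI t)
          (bidsAt_nonneg hI ht)]
  exact key _ le_rfl

/-! ### The primal objective -/

theorem mem_assignedEvent_append_singleton {Ω : Type*} [MeasurableSpace Ω] (Q : PanOCS A Ω)
    (L : List (ComboPair A)) (p : ComboPair A) (a : A) (y : ℝ) (ω : Ω) :
    ω ∈ Q.assignedEvent (L ++ [p]) a y ↔ ω ∈ Q.assignedEvent L a y ∨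
      ((Q.selected ω L p).1 = a ∧ y ∈ (Q.selected ω L p).2) := by
  simp only [PanOCS.assignedEvent, mem_ofPred_eq, Fin.exists_iff, List.get_eq_getElem]
  constructor
  · rintro ⟨t, ht, h⟩
    rw [List.length_append, List.length_singleton] at ht
    rcases Nat.lt_succ_iff_lt_or_eq.1 ht with hlt | rfl
    · rw [List.take_append_of_le_length hlt.le, List.getElem_append_left hlt] at h
      exact Or.inl ⟨t, hlt, h⟩
    · simpa using Or.inr h
  · rintro (⟨t, ht, h⟩ | h)
    · refine ⟨t, by simp; omega, ?_⟩
      rwa [List.take_append_of_le_length ht.le, List.getElem_append_left ht]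
    · exact ⟨L.length, by simp, by simpa using h⟩

theorem semiCount_append_singleton (L : List (ComboPair A)) (p : ComboPair A) (a : A) (y : ℝ) :
    semiCount (L ++ [p]) a y = semiCount L a y +
      open Classical in if (p.1.1 = a ∧ y ∈ p.1.2) ∨ (p.2.1 = a ∧ y ∈ p.2.2) then 1 else 0 := by
  classical
  simp [semiCount, List.countP_append, List.countP_singleton]

/-- The counter is infinite or the number of semi-assignments. -/
theorem k_eq_top_or_semiCount (I : List (A → ℝ)) (a : A) (y : ℝ) :
    (runState B γ Δα T I).k a y = ⊤ ∨
      (runState B γ Δα T I).k a y = semiCount (runState B γ Δα T I).semi a y := by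
  classical
  induction I using List.reverseRecOn with
  | nil => exact Or.inr (by simp [runState, State.init, semiCount])
  | append_singleton I b ih =>
    rw [runState_append_singleton]
    set st := runState B γ Δα T I
    cases hd : decision B γ Δα T st b with
    | randomized a₁ a₂ =>
      rw [step_of_randomized hd]
      simp only [semiCount_append_singleton, State.pair]
      have hiff : ((a₁ = a ∧ y ∈ st.subset B b a₁) ∨ (a₂ = a ∧ y ∈ st.subset B b a₂)) ↔
          (a = a₁ ∨ a = a₂) ∧ y ∈ st.subset B b a := by
        constructor
        · rintro (⟨rfl, h⟩ | ⟨rfl, h⟩)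
          exacts [⟨Or.inl rfl, h⟩, ⟨Or.inr rfl, h⟩]
        · rintro ⟨rfl | rfl, h⟩
          exacts [Or.inl ⟨rfl, h⟩, Or.inr ⟨rfl, h⟩]
      simp only [hiff]
      split_ifs
      · rcases ih with h | h
        · exact Or.inl (by rw [h]; rfl)
        · exact Or.inr (by rw [h]; norm_cast)
      · simpa using ih
    | deterministic d =>
      rw [step_of_deterministic hd]
      simp only
      split_ifs
      · exact Or.inl rfl
      · exact ih

theorem measurableSet_of_mem_semi (hB : ∀ a, 0 < B a) (I : List (A → ℝ))
    (hI : ∀ b ∈ I, ∀ a, 0 ≤ b a) :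
    ∀ p ∈ (runState B γ Δα T I).semi, MeasurableSet p.1.2 ∧ MeasurableSet p.2.2 := by
  induction I using List.reverseRecOn with
  | nil => simp [runState, State.init]
  | append_singleton I b ih =>
    have hI' : ∀ b ∈ I, ∀ a, 0 ≤ b a := fun b' hb' => hI b' (by simp [hb'])
    have hst := isValid_runState (γ := γ) (Δα := Δα) (T := T) hB I hI'
    specialize ih hI'
    rw [runState_append_singleton]
    set st := runState B γ Δα T I
    cases hd : decision B γ Δα T st b with
    | randomized a₁ a₂ =>
      rw [step_of_randomized hd]
      intro p hp
      rcases List.mem_append.1 hp with hp | hp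
      · exact ih p hp
      · rw [List.mem_singleton.1 hp]
        exact ⟨hst.measurableSet_subset b a₁, hst.measurableSet_subset b a₂⟩
    | deterministic d =>
      rw [step_of_deterministic hd]
      exact ih

variable {Ω : Type*} [MeasurableSpace Ω] {Q : PanOCS A Ω}

/-- The points of `a` that are covered by the assigned impressions, jointly with the seed. -/
def coveredSet (k : ℝ → ℕ∞) (Q : PanOCS A Ω) (L : List (ComboPair A)) (a : A) : Set (Ω × ℝ) :=
  {x | k x.2 = ⊤ ∨ x.1 ∈ Q.assignedEvent L a x.2}

/-- Coverage by the PanOCS is a finite union of rectangles, one pair per round; joint measurability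
is what Fubini requires. -/
theorem measurableSet_coveredSet {k : ℝ → ℕ∞} (hk : Measurable k) {L : List (ComboPair A)}
    (hL : ∀ p ∈ L, MeasurableSet p.1.2 ∧ MeasurableSet p.2.2) (a : A) :
    MeasurableSet (coveredSet k Q L a) := by
  refine MeasurableSet.union (measurable_snd (hk (measurableSet_singleton ⊤))) ?_
  have : {x : Ω × ℝ | x.1 ∈ Q.assignedEvent L a x.2} = ⋃ t : Fin L.length,
      ({ω | Q.select ω (L.take t) (L.get t) = true} ×ˢ
          {y | (L.get t).1.1 = a ∧ y ∈ (L.get t).1.2}) ∪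
        ({ω | Q.select ω (L.take t) (L.get t) = false} ×ˢ
          {y | (L.get t).2.1 = a ∧ y ∈ (L.get t).2.2}) := by
    ext ⟨ω, y⟩
    simp only [PanOCS.assignedEvent, mem_ofPred_eq, mem_iUnion, PanOCS.selected, mem_union,
      mem_prod]
    refine exists_congr fun t => ?_
    cases Q.select ω (L.take t) (L.get t) <;> simp
  refine (congrArg MeasurableSet this).mpr (MeasurableSet.iUnion fun t => ?_)
  have hp := hL (L.get t) (List.get_mem L t)
  have hQ := Q.measurable_select (L.take t) (L.get t)
  exact ((hQ (measurableSet_singleton true)).prod ((MeasurableSet.const _).inter hp.1)).union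
    ((hQ (measurableSet_singleton false)).prod ((MeasurableSet.const _).inter hp.2))

/-- Covered points lie in the scanned subset of some assigned impression. -/
theorem exists_of_covered (I : List (A → ℝ)) (ω : Ω) (a : A) (y : ℝ) {t : ℕ}
    (ht : t ≤ I.length)
    (h : (ω, y) ∈ coveredSet ((stateAt B γ Δα T I t).k a) Q (stateAt B γ Δα T I t).semi a) :
    ∃ i < t, (basicAlgorithm B γ Δα T Q).assign ω (I.take i) (bidsAt I i) = a ∧
      y ∈ (stateAt B γ Δα T I i).subset B (bidsAt I i) a := by
  classical
  induction t with
  | zero => simp [coveredSet, stateAt, runState, State.init, PanOCS.assignedEvent] at h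
  | succ t ih =>
    specialize ih (by omega)
    rw [stateAt_succ I ht] at h
    -- If the point was not covered before round `t`, then round `t` itself covers it, either by
    -- selection or by a deterministic assignment.
    by_cases hprev : (ω, y) ∈
        coveredSet ((stateAt B γ Δα T I t).k a) Q (stateAt B γ Δα T I t).semi a
    · obtain ⟨i, hi, hi'⟩ := ih hprev
      exact ⟨i, by omega, hi'⟩
    · refine ⟨t, by omega, ?_⟩
      simp only [coveredSet, mem_ofPred_eq, not_or] at hprev h
      have hassign : (basicAlgorithm B γ Δα T Q).assign ω (I.take t) (bidsAt I t) =
          match decision B γ Δα T (stateAt B γ Δα T I t) (bidsAt I t) with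
          | .randomized a₁ a₂ => (Q.selected ω (stateAt B γ Δα T I t).semi
              ((stateAt B γ Δα T I t).pair B (bidsAt I t) a₁ a₂)).1
          | .deterministic d => d := rfl
      rw [hassign]
      set st := stateAt B γ Δα T I t
      cases hd : decision B γ Δα T st (bidsAt I t) with
      | randomized a₁ a₂ =>
        rw [step_of_randomized hd] at h
        simp only [mem_assignedEvent_append_singleton] at h
        have hnt : ¬ (if (a = a₁ ∨ a = a₂) ∧ y ∈ st.subset B (bidsAt I t) a then st.k a y + 1
            else st.k a y) = ⊤ := by
          split_ifs
          · simpa using hprev.1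
          · exact hprev.1
        obtain ⟨h₁, h₂⟩ := (h.resolve_left hnt).resolve_left hprev.2
        refine ⟨h₁, ?_⟩
        simp only [PanOCS.selected] at h₁ h₂
        split_ifs at h₁ h₂
        · rw [← h₁]
          exact h₂
        · rw [← h₁]
          exact h₂
      | deterministic d =>
        rw [step_of_deterministic hd] at h
        have h₁ := h.resolve_right hprev.2
        simp only at h₁
        split_ifs at h₁ with hcond
        · exact ⟨hcond.1.symm, hcond.2⟩
        · exact absurd h₁ hprev.1

/-- Both terms of the minimum in the payment bound the covered measure: the union of the assigned
scanned subsets gives the sum of bids, and the length of the interval gives the budget. -/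
theorem volume_real_covered_le_payment [DecidableEq A] (hB : ∀ a, 0 < B a) (I : List (A → ℝ))
    (hI : ∀ b ∈ I, ∀ a, 0 ≤ b a) (ω : Ω) (a : A) :
    (volume.restrict (Ico 0 (B a))).real
        (Prod.mk ω ⁻¹' coveredSet ((runState B γ Δα T I).k a) Q (runState B γ Δα T I).semi a) ≤
      payment B I a (Finset.univ.filter fun i =>
        (basicAlgorithm B γ Δα T Q).assign ω (I.take i) (I.get i) = a) := by
  set W := Prod.mk ω ⁻¹' coveredSet ((runState B γ Δα T I).k a) Q (runState B γ Δα T I).semi a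
  rw [measureReal_restrict_apply' measurableSet_Ico]
  refine le_min ?_ ?_
  · have hY : ∀ i : Fin I.length, volume.real ((stateAt B γ Δα T I i).subset B (bidsAt I i) a) ≤
        I.get i a := fun i => by
      have hv := isValid_stateAt (γ := γ) (Δα := Δα) (T := T) hB hI i a
      rw [← bidsAt_fin]
      exact volume_real_panSubset_le (measurableSet_topSet _ hv.measurable) (topSet_subset _ _)
        hv.start_mem (bidsAt_nonneg hI i.2 a)
    refine le_trans (measureReal_mono (fun y hy => ?_) ?_)
      ((measureReal_biUnion_finset_le _ fun i : Fin I.length =>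
        (stateAt B γ Δα T I i).subset B (bidsAt I i) a).trans (Finset.sum_le_sum fun i _ => hY i))
    · have hy' := hy.1
      simp only [W, ← stateAt_length I, mem_preimage] at hy'
      obtain ⟨i, hi, h₁, h₂⟩ := exists_of_covered I ω a y le_rfl hy'
      refine mem_iUnion₂.2 ⟨⟨i, hi⟩, ?_, h₂⟩
      rw [Finset.mem_filter, ← bidsAt_fin]
      exact ⟨Finset.mem_univ _, h₁⟩
    · exact volume_ne_top_of_subset_Ico (B := B a) (iUnion₂_subset fun i _ =>
        (isValid_stateAt hB hI i).subset_Ico (bidsAt_nonneg hI i.2) a)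
  · calc volume.real (W ∩ Ico 0 (B a)) ≤ volume.real (Ico 0 (B a)) :=
          measureReal_mono inter_subset_right measure_Ico_lt_top.ne
      _ = B a := by rw [Real.volume_real_Ico_of_le (hB a).le, sub_zero]

/-- The two ways of integrating the measure of the sections of a set. -/
theorem integral_measureReal_sections {X Z : Type*} [MeasurableSpace X] [MeasurableSpace Z]
    (μ : Measure X) (ν : Measure Z) [IsFiniteMeasure μ] [IsFiniteMeasure ν] {W : Set (X × Z)}
    (hW : MeasurableSet W) :
    Integrable (fun x => ν.real (Prod.mk x ⁻¹' W)) μ ∧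
      Integrable (fun z => μ.real ((fun x => (x, z)) ⁻¹' W)) ν ∧
      ∫ x, ν.real (Prod.mk x ⁻¹' W) ∂μ = ∫ z, μ.real ((fun x => (x, z)) ⁻¹' W) ∂ν := by
  refine ⟨?_, ?_, ?_⟩
  · refine Integrable.of_bound
      (measurable_measure_prodMk_left hW).ennreal_toReal.aestronglyMeasurable (ν.real univ)
      (Filter.Eventually.of_forall fun x => ?_)
    rw [Real.norm_eq_abs, abs_of_nonneg measureReal_nonneg]
    exact measureReal_mono (subset_univ _)
  · refine Integrable.of_bound
      (measurable_measure_prodMk_right hW).ennreal_toReal.aestronglyMeasurable (μ.real univ)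
      (Filter.Eventually.of_forall fun x => ?_)
    rw [Real.norm_eq_abs, abs_of_nonneg measureReal_nonneg]
    exact measureReal_mono (subset_univ _)
  · simp only [measureReal_def]
    rw [integral_toReal (measurable_measure_prodMk_left hW).aemeasurable
        (Filter.Eventually.of_forall fun x => measure_lt_top _ _),
      integral_toReal (measurable_measure_prodMk_right hW).aemeasurable
        (Filter.Eventually.of_forall fun x => measure_lt_top _ _),
      ← Measure.prod_apply hW, Measure.prod_apply_symm hW]

theorem integrable_objective [Fintype A] [DecidableEq A] (alg : OnlineAlgorithm A Ω)
    (P : Measure Ω) [IsFiniteMeasure P] (B : A → ℝ) (I : List (A → ℝ)) :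
    Integrable (fun ω => objective B I fun i => alg.assign ω (I.take i) (I.get i)) P := by
  -- The objective depends on the seed only through a finite discrete assignment, hence is
  -- measurable and bounded.
  let _ : MeasurableSpace A := ⊤
  have hmeas : Measurable fun ω => fun i : Fin I.length => alg.assign ω (I.take i) (I.get i) :=
    measurable_pi_lambda _ fun i => measurable_to_countable' fun a =>
      alg.measurableSet_assign (I.take i) (I.get i) a
  obtain ⟨C, hC⟩ := (Set.finite_range fun f : Fin I.length → A => |objective B I f|).bddAbove
  exact Integrable.of_bound
    ((Measurable.of_discrete (f := objective B I)).comp hmeas).aestronglyMeasurable C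
    (Filter.Eventually.of_forall fun ω => hC (mem_range_self _))

/-- After exchanging the integrals, the claim is pointwise in `y`: a point at `⊤` is covered with
probability one, and otherwise the counter is the number of pairs in the PanOCS guarantee. -/
theorem integral_headSum_deltaX_le (hB : ∀ a, 0 < B a) (hγ₀ : 0 ≤ γ) (hγ₁ : γ ≤ 1)
    {P : Measure Ω} [IsProbabilityMeasure P] {𝒮 : Set (List (ComboPair A))}
    (hQ : Q.IsGammaOn P B γ 𝒮) (I : List (A → ℝ)) (hI : ∀ b ∈ I, ∀ a, 0 ≤ b a)
    (hI𝒮 : (runState B γ Δα T I).semi ∈ 𝒮) (a : A) :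
    ∫ y in Ico 0 (B a), headSum (deltaX γ) ((runState B γ Δα T I).k a y) ≤
      ∫ ω, (volume.restrict (Ico 0 (B a))).real
        (Prod.mk ω ⁻¹' coveredSet ((runState B γ Δα T I).k a) Q
          (runState B γ Δα T I).semi a) ∂P := by
  have hk := (isValid_runState (γ := γ) (Δα := Δα) (T := T) hB I hI a).measurable
  have hW := measurableSet_coveredSet (Q := Q) hk
    (measurableSet_of_mem_semi (γ := γ) (Δα := Δα) (T := T) hB I hI) a
  have : IsFiniteMeasure (volume.restrict (Ico 0 (B a))) :=
    isFiniteMeasure_restrict.2 measure_Ico_lt_top.ne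
  obtain ⟨-, h₂, h₃⟩ := integral_measureReal_sections P (volume.restrict (Ico 0 (B a))) hW
  rw [h₃]
  refine setIntegral_mono_on (integrableOn_headSum (hasSum_deltaX hγ₀ hγ₁).summable
    (fun j _ => deltaX_nonneg hγ₀ hγ₁ j) hk measure_Ico_lt_top.ne) h₂ measurableSet_Ico
    fun y hy => ?_
  rcases k_eq_top_or_semiCount (B := B) (γ := γ) (Δα := Δα) (T := T) I a y with htop | hcount
  · rw [htop, headSum_deltaX_top hγ₀ hγ₁]
    have : (fun ω => (ω, y)) ⁻¹' coveredSet ((runState B γ Δα T I).k a) Q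
        (runState B γ Δα T I).semi a = univ := eq_univ_of_forall fun ω => Or.inl htop
    rw [this, probReal_univ]
  · rw [hcount, headSum_deltaX_natCast]
    exact (hQ _ hI𝒮 a y hy).trans (measureReal_mono fun ω hω => Or.inr hω)

/-- The expected objective is at least the value of the dual solution. -/
theorem sum_dual_le_expectedObjective [Fintype A] [DecidableEq A] (hB : ∀ a, 0 < B a)
    (hγ₀ : 0 ≤ γ) (hγ₁ : γ ≤ 1) (hLP : FactorLPFeasible γ Γ Δα (deltaBeta γ Δα))
    {P : Measure Ω} [IsProbabilityMeasure P] {𝒮 : Set (List (ComboPair A))}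
    (hQ : Q.IsGammaOn P B γ 𝒮) (I : List (A → ℝ)) (hI : ∀ b ∈ I, ∀ a, 0 ≤ b a)
    (hI𝒮 : (runState B γ Δα T I).semi ∈ 𝒮) :
    ∑ a, alphaVar B γ Δα T I a + ∑ i, betaVar B γ Δα T I i ≤
      (basicAlgorithm B γ Δα T Q).expectedObjective P B I := by
  have hk : ∀ a, Measurable ((runState B γ Δα T I).k a) := fun a =>
    (isValid_runState hB I hI a).measurable
  -- The identity `Δα + Δβ = Δx` merges both kinds of dual charge at each point.
  have hdual : ∀ a, alphaVar B γ Δα T I a +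
      ∫ y in Ico 0 (B a), headSum (deltaBeta γ Δα) ((runState B γ Δα T I).k a y) =
      ∫ y in Ico 0 (B a), headSum (deltaX γ) ((runState B γ Δα T I).k a y) := fun a => by
    rw [alphaVar, ← integral_add
      (integrableOn_headSum (hLP.summable_alpha hγ₀ hγ₁) hLP.alpha_nonneg (hk a)
        measure_Ico_lt_top.ne)
      (integrableOn_headSum (hLP.summable_beta hγ₀ hγ₁) hLP.beta_nonneg (hk a)
        measure_Ico_lt_top.ne)]
    simp only [hLP.headSum_alpha_add_beta hγ₀ hγ₁]
  have hint : ∀ a, Integrable (fun ω => (volume.restrict (Ico 0 (B a))).real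
      (Prod.mk ω ⁻¹' coveredSet ((runState B γ Δα T I).k a) Q
        (runState B γ Δα T I).semi a)) P := fun a => by
    have : IsFiniteMeasure (volume.restrict (Ico 0 (B a))) :=
      isFiniteMeasure_restrict.2 measure_Ico_lt_top.ne
    exact (integral_measureReal_sections P _ (measurableSet_coveredSet (hk a)
      (measurableSet_of_mem_semi hB I hI) a)).1
  rw [sum_betaVar hB hγ₀ hγ₁ hLP I hI, ← Finset.sum_add_distrib,
    Finset.sum_congr rfl fun a _ => hdual a]
  refine (Finset.sum_le_sum fun a _ =>
    integral_headSum_deltaX_le hB hγ₀ hγ₁ hQ I hI hI𝒮 a).trans ?_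
  rw [← integral_finsetSum _ fun a _ => hint a]
  exact integral_mono (integrable_finsetSum _ fun a _ => hint a) (integrable_objective _ P B I)
    fun ω => Finset.sum_le_sum fun a _ => volume_real_covered_le_payment hB I hI ω a

end

/-- Weak duality for the configuration LP. -/
theorem ApproxDualFeasible.mul_offlineOpt_le {A : Type*} [Fintype A] [DecidableEq A] [Nonempty A]
    {B : A → ℝ} {Γ : ℝ} {I : List (A → ℝ)} {α : A → ℝ} {β : Fin I.length → ℝ}
    (h : ApproxDualFeasible B Γ I α β) : Γ * offlineOpt B I ≤ ∑ a, α a + ∑ i, β i := by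
  obtain ⟨f, hf⟩ := exists_eq_ciSup_of_finite (f := fun f : Fin I.length → A => objective B I f)
  -- The fibres of an optimal assignment partition the impressions, so each `β` is counted once when
  -- the dual constraints are summed.
  rw [offlineOpt, ← hf, objective, Finset.mul_sum, ← Finset.sum_fiberwise Finset.univ f β,
    ← Finset.sum_add_distrib]
  exact Finset.sum_le_sum fun a _ => h.2.2 a _

end AdWords

theorem mainTheorem6 {A Ω : Type*} [Fintype A] [DecidableEq A] [MeasurableSpace Ω]
    (P : Measure Ω) [IsProbabilityMeasure P]
    (B : A → ℝ) (hB : ∀ a, 0 < B a)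
    (γ Γ : ℝ) (hγ₀ : 0 ≤ γ) (hγ₁ : γ ≤ 1)
    (Δα Δβ : ℕ → ℝ) (hLP : AdWords.FactorLPFeasible γ Γ Δα Δβ)
    (T : AdWords.ArgmaxRule A)
    (Q : AdWords.PanOCS A Ω) (𝒮 : Set (List (AdWords.ComboPair A)))
    (hQ : Q.IsGammaOn P B γ 𝒮) :
    (∀ I : List (A → ℝ), (∀ b ∈ I, ∀ a, 0 ≤ b a) →
      AdWords.ApproxDualFeasible B Γ I
        (AdWords.alphaVar B γ Δα T I) (AdWords.betaVar B γ Δα T I)) ∧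
    (AdWords.basicAlgorithm B γ Δα T Q).IsCompetitiveOn P B Γ
      {I | (∀ b ∈ I, ∀ a, 0 ≤ b a) ∧ (AdWords.runState B γ Δα T I).semi ∈ 𝒮} := by
  have hLP' := hLP.to_deltaBeta
  have hdual := AdWords.approxDualFeasible (T := T) hB hγ₀ hγ₁ hLP'
  -- Makes the set of assignments nonempty, so that the offline optimum is attained.
  have : Nonempty A := ⟨T.top [] 0⟩
  exact ⟨hdual, fun I hI => (hdual I hI.1).mul_offlineOpt_le.trans
    (AdWords.sum_dual_le_expectedObjective hB hγ₀ hγ₁ hLP' hQ I hI.1 hI.2)⟩
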